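/- Let $k$ be a field of characteristic $0$ and let $\Gamma$ be a nontrivial abelian monoid that has an admissible well order, i.e. a well order $<$ such that $\gamma_1<\gamma_2$ implies $\gamma+\gamma_1<\gamma+\gamma_2$ for all $\gamma\in\Gamma$. Let $H=\bigoplus_{\gamma\in\Gamma}H_\gamma$ be a connected $\Gamma$-graded Hopf algebra over $k$: the decomposition is a grading of both the algebra and the coalgebra $H$, and $\dim_k H_0=1$. Let $A\supseteq B$ be homogeneous left (resp. right) coideal subalgebras of $H$, i.e. subalgebras $K$ that are homogeneous subspaces and satisfy $\Delta(K)\subseteq H\otimes K$ (resp. $\Delta(K)\subseteq K\otimes H$). For a family $\{z_\xi\}_{\xi\in\Xi}$ of elements of $A$ and a total order $<$ on $\Xi$, call $(\{z_\xi\}_{\xi\in\Xi},<)$ a system of PBW generators of $A$ over $B$ (with all heights infinite) if the ordered monomials $z_{\xi_1}^{r_1}\cdots z_{\xi_m}^{r_m}$ with $m\ge 0$, $\xi_1<\cdots<\xi_m$ in $\Xi$ and $r_i\ge 1$ form a basis of $A$ as a left $B$-module as well as of $A$ as a right $B$-module; here and below, monomials are indexed by their exponents (so different exponents give different basis elements).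 Then there exist a family $\{z_\xi\}_{\xi\in\Xi}$ of homogeneous elements of $A_+=\bigoplus_{\gamma\ne 0}(A\cap H_\gamma)$ and a total order $\vartriangleleft$ on $\Xi$ such that: 1. $(\{z_\xi\}_{\xi\in\Xi},<)$ is a system of PBW generators of $A$ over $B$ for every total order $<$ on $\Xi$. 2. For each $\xi\in\Xi$, let $A^{\trianglelefteq\xi}$ be the subalgebra of $A$ generated by $B$ and all $z_\eta$ with $\eta\trianglelefteq\xi$. The monomials $z_{\xi_1}^{r_1}\cdots z_{\xi_m}^{r_m}$ with $m\ge0$, $\xi_1\vartriangleleft\cdots\vartriangleleft\xi_m\trianglelefteq\xi$ and $r_i\ge 1$ form a basis of $A^{\trianglelefteq\xi}$ as a left $B$-module as well as a right $B$-module. 3. For each $\xi\in\Xi$, $A^{\trianglelefteq\xi}$ is a left (resp. right) coideal of $H$, i.e. $\Delta(A^{\trianglelefteq\xi})\subseteq H\otimes A^{\trianglelefteq\xi}$ (resp. $\Delta(A^{\trianglelefteq\xi})\subseteq A^{\trianglelefteq\xi}\otimes H$); and it is a Hopf subalgebra of $H$ if both $A$ and $B$ are Hopf subalgebras of $H$.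 4. For all $\xi,\eta\in\Xi$ with $\eta\vartriangleleft\xi$, one has $[z_\xi,z_\eta]=z_\xi z_\eta-z_\eta z_\xi\in\bigcup_{\delta\vartriangleleft\xi}A^{\trianglelefteq\delta}$. -/

import Mathlib

open scoped TensorProduct

universe u v w

namespace CoidealPBW

/-- A relation `r` (read `a < b`) on an additive commutative monoid is an *admissible well order* if
it is a well order (in particular a strict total order) and `a < b` implies `c + a < c + b`. -/
def IsAdmissibleWellOrder {Γ : Type w} [AddCommMonoid Γ] (r : Γ → Γ → Prop) : Prop :=
  IsWellOrder Γ r ∧ ∀ a b c : Γ, r a b → r (c + a) (c + b)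

section Modules

variable {k : Type u} {H : Type v} [Field k] [Ring H] [Algebra k H]

/-- The subspace `U ⊗ V` of `H ⊗ H`, for subspaces `U`, `V` of `H`. -/
def tensorSub (U V : Submodule k H) : Submodule k (H ⊗[k] H) :=
  LinearMap.range (TensorProduct.mapIncl U V)

/-- The family `v` is a basis of `A` as a left module over the subalgebra `B ⊆ A`. -/
def IsLeftBasis {ι : Type*} (B A : Subalgebra k H) (v : ι → H) : Prop :=
  LinearIndependent B v ∧ (Submodule.span B (Set.range v) : Set H) = (A : Set H)

/-- The family `v` is a basis of `A` as a right module over the subalgebra `B ⊆ A`. The algebra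
`B.op`, which is `B` inside the opposite algebra of `H`, acts on `H` by right multiplication. -/
def IsRightBasis {ι : Type*} (B A : Subalgebra k H) (v : ι → H) : Prop :=
  LinearIndependent B.op v ∧ (Submodule.span B.op (Set.range v) : Set H) = (A : Set H)

/-- For an exponent function `r` with support `ξ₁ < ⋯ < ξₘ`, the ordered monomial
`z_{ξ₁} ^ r(ξ₁) ⋯ z_{ξₘ} ^ r(ξₘ)`. -/
def monomial {Ξ : Type*} (ord : LinearOrder Ξ) (z : Ξ → H) (r : Ξ →₀ ℕ) : H :=
  ((r.support.sort (fun a b => a ≤ b)).map (fun ξ => z ξ ^ r ξ)).prod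

/-- `(z, h, <)` is a *system of PBW generators of `A` over `B`*: all heights are at least `2`, and
the ordered monomials in the `z ξ` whose exponent at each `ξ` is less than `h ξ`
form a basis of `A` as a left `B`-module and as a right `B`-module. -/
structure IsPBWSystem {Ξ : Type*} (B A : Subalgebra k H) (z : Ξ → H) (h : Ξ → ℕ∞)
    (ord : LinearOrder Ξ) : Prop where
  mem : ∀ ξ, z ξ ∈ A
  two_le : ∀ ξ, 2 ≤ h ξ
  left_basis : IsLeftBasis B A
    (fun r : {r : Ξ →₀ ℕ // ∀ ξ, (r ξ : ℕ∞) < h ξ} => monomial ord z r.1)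
  right_basis : IsRightBasis B A
    (fun r : {r : Ξ →₀ ℕ // ∀ ξ, (r ξ : ℕ∞) < h ξ} => monomial ord z r.1)

/-- The subalgebra generated over `B` by the `z η` with `η ≤ ξ`. -/
def truncation {Ξ : Type*} (B : Subalgebra k H) (z : Ξ → H) (ord : LinearOrder Ξ) (ξ : Ξ) :
    Subalgebra k H :=
  Algebra.adjoin k ((B : Set H) ∪ {x | ∃ η, η ≤ ξ ∧ z η = x})

end Modules

section Coalgebras

variable {k : Type u} {H : Type v} [Field k] [Ring H] [HopfAlgebra k H]

/-- The decomposition of `H` into the `𝒜 γ` is compatible with the coalgebra structure: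
`Δ(H_γ) ⊆ ∑_{α + β = γ} H_α ⊗ H_β`, and the counit vanishes on `H_γ` for `γ ≠ 0`. -/
structure IsCoalgebraGrading {Γ : Type w} [AddCommMonoid Γ] (𝒜 : Γ → Submodule k H) : Prop where
  comul_mem : ∀ γ, ∀ x ∈ 𝒜 γ, Coalgebra.comul (R := k) x ∈
    ⨆ p : {p : Γ × Γ // p.1 + p.2 = γ}, tensorSub (𝒜 p.1.1) (𝒜 p.1.2)
  counit_eq_zero : ∀ γ, γ ≠ 0 → ∀ x ∈ 𝒜 γ, Coalgebra.counit (R := k) x = 0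

/-- The two sides on which a coideal can live. -/
inductive Side where
  | left
  | right

/-- `K` is a left coideal if `Δ(K) ⊆ H ⊗ K`, and a right coideal if `Δ(K) ⊆ K ⊗ H`. -/
def IsCoideal (s : Side) (K : Submodule k H) : Prop :=
  match s with
  | Side.left => ∀ x ∈ K, Coalgebra.comul (R := k) x ∈ tensorSub ⊤ K
  | Side.right => ∀ x ∈ K, Coalgebra.comul (R := k) x ∈ tensorSub K ⊤

/-- The subalgebra `K` is a Hopf subalgebra: `Δ(K) ⊆ K ⊗ K` and `S(K) ⊆ K`. -/
structure IsHopfSubalgebra (K : Subalgebra k H) : Prop where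
  comul_mem : ∀ x ∈ K, Coalgebra.comul (R := k) x ∈
    tensorSub (Subalgebra.toSubmodule K) (Subalgebra.toSubmodule K)
  antipode_mem : ∀ x ∈ K, HopfAlgebra.antipode k x ∈ K

end Coalgebras

end CoidealPBW

set_option linter.unusedSectionVars false

/-! The algebra `A` is reached from `B` through a chain of Ore steps E ⊂ E[x]: E is a homogeneous
coideal subalgebra, x ∉ E is homogeneous, [x, E] ⊆ E, and Δ(x) - 1 ⊗ x ∈ H ⊗ E. Right coideals are
treated as left coideals of the co-opposite comultiplication.

In an Ore step the powers of x are independent over E (`IsOreStep.eq_zero_of_mul_pow_mem`). The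
leading coefficients of relations of degree n form a left coideal; if it is nonzero, it meets the
complement of ker ε, and by homogeneity x^n itself is a combination of lower powers. Comparing the
coefficients of x^(n-1) under Δ then puts n x in E, against x ∉ E in characteristic 0.

To find the steps between C ⊆ D, adjoin the homogeneous elements x of D by increasing degree. Each x
is primitive modulo the part L already reached, but need not normalize L. Let M be the closure of L
under [x, -]. Then M[x] = L[x], and M ⊂ M[x] is an Ore step. As H_0 = k is central, M differs from L
only in degrees deg x + α with α ≠ 0 (`adClosure_degree`), and the inclusion L ⊆ M is refined by the
same recipe (`Jump`). For a fixed degree γ the recursion is well founded, because the remainder of γ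
after subtracting deg x drops strictly. Hence the ordered monomials span
(`IsOreChain.pair_spanned`).

The topmost generator in a monomial commutes with the others, and with `B`, up to lower powers of
itself. So neither the order of the factors nor the side of the coefficients affects leading terms,
which yields every total order and both module structures at once. -/

namespace CoidealPBW

/-! ### Contractions and subspaces of H ⊗ H -/

section Slices

variable {k : Type u} {H : Type v} [Field k] [Ring H] [Algebra k H]

/-- Contraction of the left tensor factor with a functional. -/
noncomputable def slice (f : Module.Dual k H) : H ⊗[k] H →ₗ[k] H :=
  (TensorProduct.lid k H).toLinearMap ∘ₗ LinearMap.rTensor H f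

@[simp] theorem slice_tmul (f : Module.Dual k H) (a b : H) : slice f (a ⊗ₜ[k] b) = f a • b := by
  simp [slice]

theorem tmul_mem_tensorSub {U V : Submodule k H} {a b : H} (ha : a ∈ U) (hb : b ∈ V) :
    a ⊗ₜ[k] b ∈ tensorSub U V :=
  ⟨(⟨a, ha⟩ : U) ⊗ₜ[k] (⟨b, hb⟩ : V), by simp [TensorProduct.mapIncl]⟩

theorem tensorSub_le {U V : Submodule k H} {P : Submodule k (H ⊗[k] H)}
    (h : ∀ a ∈ U, ∀ b ∈ V, a ⊗ₜ[k] b ∈ P) : tensorSub U V ≤ P := by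
  rw [tensorSub, TensorProduct.range_mapIncl, Submodule.map₂_le]
  exact h

theorem tensorSub_mono {U V U' V' : Submodule k H} (hU : U ≤ U') (hV : V ≤ V') :
    tensorSub U V ≤ tensorSub U' V' :=
  tensorSub_le fun _ ha _ hb => tmul_mem_tensorSub (hU ha) (hV hb)

theorem slice_mem_of_mem {U V : Submodule k H} {t : H ⊗[k] H} (ht : t ∈ tensorSub U V)
    (f : Module.Dual k H) : slice f t ∈ V := by
  have : tensorSub U V ≤ V.comap (slice f) := tensorSub_le fun a _ b hb => by
    simpa using V.smul_mem _ hb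
  exact this ht

/-- Expand t along a basis of the left factor: the coordinate functionals recover the right-hand
coefficients. Coideal conditions thereby become conditions inside H. -/
theorem mem_tensorSub_top_iff {V : Submodule k H} {t : H ⊗[k] H} :
    t ∈ tensorSub ⊤ V ↔ ∀ f : Module.Dual k H, slice f t ∈ V := by
  refine ⟨fun ht => slice_mem_of_mem ht, fun h => ?_⟩
  let b := Module.Basis.ofVectorSpace k H
  obtain ⟨c, rfl⟩ := TensorProduct.eq_repr_basis_left b t
  refine Submodule.sum_mem _ fun i _ => tmul_mem_tensorSub trivial ?_
  have := h (b.coord i)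
  rw [Finsupp.sum, map_sum, Finset.sum_eq_single i] at this
  · simpa using this
  · intro j _ hj
    simp [Finsupp.single_eq_of_ne hj.symm]
  · intro hi
    simp [Finsupp.notMem_support_iff.1 hi]

theorem eq_zero_of_slice_eq_zero {t : H ⊗[k] H} (h : ∀ f : Module.Dual k H, slice f t = 0) :
    t = 0 := by
  have : t ∈ tensorSub (⊤ : Submodule k H) (⊥ : Submodule k H) :=
    mem_tensorSub_top_iff.2 fun f => by simpa using h f
  have h0 : tensorSub (⊤ : Submodule k H) (⊥ : Submodule k H) ≤ ⊥ := tensorSub_le fun a _ b hb => by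
    simp [(Submodule.mem_bot k).1 hb]
  simpa using h0 this

theorem mul_mem_tensorSub_top {U V W : Submodule k H} (h : ∀ a ∈ U, ∀ b ∈ V, a * b ∈ W)
    {s t : H ⊗[k] H} (hs : s ∈ tensorSub ⊤ U) (ht : t ∈ tensorSub ⊤ V) :
    s * t ∈ tensorSub ⊤ W := by
  have h1 : ∀ t ∈ tensorSub ⊤ V, tensorSub ⊤ U ≤ (tensorSub ⊤ W).comap (LinearMap.mulRight k t) := by
    intro t ht
    refine tensorSub_le fun a _ b hb => ?_
    have h2 : tensorSub ⊤ V ≤ (tensorSub ⊤ W).comap (LinearMap.mulLeft k (a ⊗ₜ[k] b)) :=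
      tensorSub_le fun c _ d hd => by
        simpa using tmul_mem_tensorSub (Submodule.mem_top (x := a * c)) (h b hb d hd)
    exact h2 ht
  exact h1 t ht hs

theorem slice_mul_one_tmul (f : Module.Dual k H) (t : H ⊗[k] H) (y : H) :
    slice f (t * (1 ⊗ₜ[k] y)) = slice f t * y := by
  have : slice f ∘ₗ LinearMap.mulRight k ((1 : H) ⊗ₜ[k] y) = LinearMap.mulRight k y ∘ₗ slice f := by
    ext a b
    simp
  exact LinearMap.congr_fun this t

theorem one_tmul_mem_tensorSub {V : Submodule k H} {a : H} (ha : a ∈ V) :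
    (1 : H) ⊗ₜ[k] a ∈ tensorSub ⊤ V := tmul_mem_tensorSub trivial ha

/-- A linear projection onto U, applied to the left factor, fixes U ⊗ H and maps H ⊗ V into U ⊗ V.
-/
theorem mem_tensorSub_of_mem_of_mem {U V : Submodule k H} {t : H ⊗[k] H}
    (h1 : t ∈ tensorSub ⊤ V) (h2 : t ∈ tensorSub U ⊤) : t ∈ tensorSub U V := by
  obtain ⟨g, hg⟩ := U.subtype.exists_leftInverse_of_injective (by simp)
  let π : H →ₗ[k] H := U.subtype ∘ₗ g
  have hπU : ∀ a ∈ U, π a = a := fun a ha => by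
    have := LinearMap.congr_fun hg ⟨a, ha⟩
    simpa [π] using congrArg Subtype.val this
  have hπm : ∀ a, π a ∈ U := fun a => (g a).2
  have e1 : tensorSub U ⊤ ≤ LinearMap.eqLocus (TensorProduct.map π LinearMap.id) LinearMap.id :=
    tensorSub_le fun a ha b _ => by simp [LinearMap.mem_eqLocus, hπU a ha]
  have e2 : tensorSub ⊤ V ≤ (tensorSub U V).comap (TensorProduct.map π LinearMap.id) :=
    tensorSub_le fun a _ b hb => by simpa using tmul_mem_tensorSub (hπm a) hb
  have := e2 h1
  rwa [Submodule.mem_comap, LinearMap.mem_eqLocus.1 (e1 h2)] at this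

end Slices

/-! ### Homogeneous subspaces and subalgebras -/

section Grading

variable {k : Type u} {H : Type v} [Field k] [Ring H] [Algebra k H]
variable {Γ : Type w} [AddCommMonoid Γ] [LinearOrder Γ]
variable (𝒜 : Γ → Submodule k H) [GradedAlgebra 𝒜]

theorem proj_of_mem_same {γ : Γ} {x : H} (hx : x ∈ 𝒜 γ) : GradedAlgebra.proj 𝒜 γ x = x :=
  DirectSum.decompose_of_mem_same 𝒜 hx

theorem proj_of_mem_ne {γ δ : Γ} {x : H} (hx : x ∈ 𝒜 γ) (h : γ ≠ δ) :
    GradedAlgebra.proj 𝒜 δ x = 0 :=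
  DirectSum.decompose_of_mem_ne 𝒜 hx h

theorem proj_mem (γ : Γ) (x : H) : GradedAlgebra.proj 𝒜 γ x ∈ 𝒜 γ :=
  (DirectSum.decompose 𝒜 x γ).2

theorem proj_mem_of_mem {P : Submodule k H} {γ δ : Γ} {x : H} (hx : x ∈ 𝒜 γ)
    (h : γ = δ → x ∈ P) : GradedAlgebra.proj 𝒜 δ x ∈ P := by
  by_cases e : γ = δ
  · subst e
    rw [proj_of_mem_same 𝒜 hx]
    exact h rfl
  · rw [proj_of_mem_ne 𝒜 hx e]
    exact P.zero_mem

theorem mem_of_proj_mem {P : Submodule k H} {x : H}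
    (h : ∀ γ, GradedAlgebra.proj 𝒜 γ x ∈ P) : x ∈ P := by
  classical
  rw [← DirectSum.sum_support_decompose 𝒜 x]
  exact P.sum_mem fun γ _ => h γ

/-- `P` is a homogeneous subspace. -/
def IsHom (P : Submodule k H) : Prop := ∀ x ∈ P, ∀ γ, GradedAlgebra.proj 𝒜 γ x ∈ P

variable {𝒜}

theorem IsHom.le_of_homogeneous {P Q : Submodule k H} (hP : IsHom 𝒜 P)
    (h : ∀ γ, ∀ x ∈ P, x ∈ 𝒜 γ → x ∈ Q) : P ≤ Q := fun x hx =>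
  mem_of_proj_mem 𝒜 fun γ => h γ _ (hP x hx γ) (proj_mem 𝒜 γ x)

/-- Linear conditions on all of `H` only need to be checked on homogeneous elements. -/
theorem homogeneous_induction {Q : Submodule k H} (h : ∀ γ, 𝒜 γ ≤ Q) (x : H) : x ∈ Q :=
  mem_of_proj_mem 𝒜 fun γ => h γ (proj_mem 𝒜 γ x)

theorem proj_mul_mem {R : Submodule k H} {x y : H} {γ : Γ}
    (h : ∀ α β, α + β = γ → GradedAlgebra.proj 𝒜 α x * GradedAlgebra.proj 𝒜 β y ∈ R) :
    GradedAlgebra.proj 𝒜 γ (x * y) ∈ R := by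
  have h1 : ∀ β, y ∈ R.comap (GradedAlgebra.proj 𝒜 γ ∘ₗ
      LinearMap.mulLeft k (GradedAlgebra.proj 𝒜 β x)) := fun β => mem_of_proj_mem 𝒜 fun δ =>
    proj_mem_of_mem 𝒜 (P := R) (SetLike.GradedMul.mul_mem (proj_mem 𝒜 β x) (proj_mem 𝒜 δ y))
      fun e => h β δ e
  have h2 : x ∈ R.comap (GradedAlgebra.proj 𝒜 γ ∘ₗ LinearMap.mulRight k y) :=
    mem_of_proj_mem 𝒜 fun β => h1 β
  exact h2

theorem proj_commutator_mem {R : Submodule k H} {x a : H} {d γ : Γ} (hx : x ∈ 𝒜 d)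
    (h : ∀ β, d + β = γ →
      x * GradedAlgebra.proj 𝒜 β a - GradedAlgebra.proj 𝒜 β a * x ∈ R) :
    GradedAlgebra.proj 𝒜 γ (x * a - a * x) ∈ R := by
  have : a ∈ R.comap (GradedAlgebra.proj 𝒜 γ ∘ₗ
      (LinearMap.mulLeft k x - LinearMap.mulRight k x)) := mem_of_proj_mem 𝒜 fun β => by
    have h1 : x * GradedAlgebra.proj 𝒜 β a - GradedAlgebra.proj 𝒜 β a * x ∈ 𝒜 (d + β) := by
      refine sub_mem (SetLike.GradedMul.mul_mem hx (proj_mem 𝒜 β a)) ?_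
      rw [add_comm]
      exact SetLike.GradedMul.mul_mem (proj_mem 𝒜 β a) hx
    exact proj_mem_of_mem 𝒜 (P := R) h1 (h β)
  exact this

theorem algebraMap_mem_zero (r : k) : algebraMap k H r ∈ 𝒜 0 := by
  rw [Algebra.algebraMap_eq_smul_one]
  exact (𝒜 0).smul_mem _ SetLike.GradedOne.one_mem

variable (𝒜) in
/-- The largest homogeneous subalgebra contained in `K`. -/
def homCore (K : Subalgebra k H) : Subalgebra k H where
  carrier := {x | ∀ γ, GradedAlgebra.proj 𝒜 γ x ∈ K}
  mul_mem' hx hy γ := proj_mul_mem (R := Subalgebra.toSubmodule K)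
    fun α β _ => K.mul_mem (hx α) (hy β)
  add_mem' hx hy γ := by
    rw [map_add]
    exact add_mem (hx γ) (hy γ)
  algebraMap_mem' r γ := proj_mem_of_mem 𝒜 (P := Subalgebra.toSubmodule K) (algebraMap_mem_zero r)
    fun _ => K.algebraMap_mem r

theorem isHom_adjoin {S : Set H} (hS : ∀ x ∈ S, ∀ γ, GradedAlgebra.proj 𝒜 γ x ∈ Algebra.adjoin k S) :
    IsHom 𝒜 (Subalgebra.toSubmodule (Algebra.adjoin k S)) := fun _ hx =>
  Algebra.adjoin_le (S := homCore 𝒜 (Algebra.adjoin k S)) hS hx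

theorem isHom_adjoin_union {C : Subalgebra k H} (hC : IsHom 𝒜 (Subalgebra.toSubmodule C)) {S : Set H}
    (hS : ∀ x ∈ S, ∃ γ, x ∈ 𝒜 γ) :
    IsHom 𝒜 (Subalgebra.toSubmodule (Algebra.adjoin k ((C : Set H) ∪ S))) := by
  refine isHom_adjoin fun x hx γ => ?_
  rcases hx with hx | hx
  · exact Algebra.subset_adjoin (Or.inl (hC x hx γ))
  · obtain ⟨β, hβ⟩ := hS x hx
    exact proj_mem_of_mem 𝒜 (P := Subalgebra.toSubmodule (Algebra.adjoin k ((C : Set H) ∪ S))) hβ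
      fun _ => Algebra.subset_adjoin (Or.inr hx)

end Grading

/-! ### The filtration of E[x] by powers of x -/

section Filtration

variable {k : Type u} {H : Type v} [Field k] [Ring H] [Algebra k H]

/-- The subspace `∑_{i < n} E x ^ i`. -/
def powFilt (E : Subalgebra k H) (x : H) : ℕ → Submodule k H
  | 0 => ⊥
  | n + 1 => powFilt E x n ⊔ (Subalgebra.toSubmodule E).map (LinearMap.mulRight k (x ^ n))

variable {E : Subalgebra k H} {x : H}

theorem mem_powFilt_succ {n : ℕ} {a : H} :
    a ∈ powFilt E x (n + 1) ↔ ∃ f ∈ powFilt E x n, ∃ e ∈ E, f + e * x ^ n = a := by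
  simp [powFilt, Submodule.mem_sup]

theorem powFilt_le_succ (n : ℕ) : powFilt E x n ≤ powFilt E x (n + 1) := le_sup_left

theorem powFilt_mono : Monotone (powFilt E x) := monotone_nat_of_le_succ powFilt_le_succ

theorem mul_pow_mem_powFilt {e : H} (he : e ∈ E) (n : ℕ) : e * x ^ n ∈ powFilt E x (n + 1) :=
  mem_powFilt_succ.2 ⟨0, zero_mem _, e, he, zero_add _⟩

theorem mem_powFilt_one {e : H} (he : e ∈ E) : e ∈ powFilt E x 1 := by
  simpa using mul_pow_mem_powFilt (x := x) he 0

theorem powFilt_le {P : Submodule k H} {n : ℕ} (h : ∀ i < n, ∀ e ∈ E, e * x ^ i ∈ P) :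
    powFilt E x n ≤ P := by
  induction n with
  | zero => exact bot_le
  | succ n ih =>
    refine sup_le (ih fun i hi => h i (hi.trans n.lt_succ_self)) ?_
    rintro _ ⟨e, he, rfl⟩
    exact h n n.lt_succ_self e he

theorem mul_mem_powFilt_of_mem_left {n : ℕ} {e f : H} (he : e ∈ E) (hf : f ∈ powFilt E x n) :
    e * f ∈ powFilt E x n := by
  have : powFilt E x n ≤ (powFilt E x n).comap (LinearMap.mulLeft k e) :=
    powFilt_le fun i hi a ha => by
      simpa [mul_assoc] using powFilt_mono (Nat.succ_le_of_lt hi)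
        (mul_pow_mem_powFilt (x := x) (mul_mem he ha) i)
  exact this hf

theorem self_mul_powFilt (had : ∀ a ∈ E, x * a - a * x ∈ E) {n : ℕ} {f : H}
    (hf : f ∈ powFilt E x n) : x * f ∈ powFilt E x (n + 1) := by
  have : powFilt E x n ≤ (powFilt E x (n + 1)).comap (LinearMap.mulLeft k x) :=
    powFilt_le fun i hi a ha => by
      have h1 := powFilt_mono (show i + 1 + 1 ≤ n + 1 by omega)
        (mul_pow_mem_powFilt (x := x) ha (i + 1))
      have h2 := powFilt_mono (show i + 1 ≤ n + 1 by omega)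
        (mul_pow_mem_powFilt (x := x) (had a ha) i)
      have := add_mem h1 h2
      rw [pow_succ'] at this
      simpa [← mul_assoc, sub_mul] using this
  exact this hf

theorem pow_mul_powFilt (had : ∀ a ∈ E, x * a - a * x ∈ E) {n m : ℕ} {f : H}
    (hf : f ∈ powFilt E x n) : x ^ m * f ∈ powFilt E x (n + m) := by
  induction m with
  | zero => simpa using hf
  | succ m ih =>
    rw [pow_succ', mul_assoc]
    exact self_mul_powFilt had ih

theorem powFilt_mul_powFilt (had : ∀ a ∈ E, x * a - a * x ∈ E) {n m : ℕ} {f g : H}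
    (hf : f ∈ powFilt E x n) (hg : g ∈ powFilt E x m) : f * g ∈ powFilt E x (m + n) := by
  have : powFilt E x n ≤ (powFilt E x (m + n)).comap (LinearMap.mulRight k g) :=
    powFilt_le fun i hi a ha => by
      have := powFilt_mono (show m + i ≤ m + n by omega)
        (mul_mem_powFilt_of_mem_left ha (pow_mul_powFilt had (m := i) hg))
      simpa [mul_assoc] using this
  exact this hf

/-- Each exchange of x with an element of E costs a commutator, which stays in E and loses one power
of x. -/
theorem pow_mul_sub_mem_powFilt (had : ∀ a ∈ E, x * a - a * x ∈ E) {e : H} (he : e ∈ E) (n : ℕ) :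
    x ^ n * e - e * x ^ n ∈ powFilt E x n := by
  induction n with
  | zero => simp
  | succ n ih =>
    have h : x ^ (n + 1) * e - e * x ^ (n + 1) =
        x * (x ^ n * e - e * x ^ n) + (x * e - e * x) * x ^ n := by
      rw [pow_succ']
      noncomm_ring
    rw [h]
    exact add_mem (self_mul_powFilt had ih) (mul_pow_mem_powFilt (had e he) n)

theorem mul_pow_mul_sub_mem_powFilt (had : ∀ a ∈ E, x * a - a * x ∈ E) {a b : H} (ha : a ∈ E)
    (hb : b ∈ E) (n : ℕ) : a * x ^ n * b - a * b * x ^ n ∈ powFilt E x n := by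
  have := mul_mem_powFilt_of_mem_left ha (pow_mul_sub_mem_powFilt had hb n)
  simpa [mul_sub, mul_assoc] using this

theorem exists_mem_powFilt (had : ∀ a ∈ E, x * a - a * x ∈ E) {a : H}
    (ha : a ∈ Algebra.adjoin k ((E : Set H) ∪ {x})) : ∃ n, a ∈ powFilt E x n := by
  induction ha using Algebra.adjoin_induction with
  | mem a ha =>
    rcases ha with ha | rfl
    · exact ⟨1, mem_powFilt_one ha⟩
    · exact ⟨2, by simpa using mul_pow_mem_powFilt (x := a) (one_mem E) 1⟩
  | algebraMap r => exact ⟨1, mem_powFilt_one (algebraMap_mem E r)⟩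
  | add a b _ _ ha hb =>
    obtain ⟨n, hn⟩ := ha
    obtain ⟨m, hm⟩ := hb
    exact ⟨max n m, add_mem (powFilt_mono (le_max_left n m) hn) (powFilt_mono (le_max_right n m) hm)⟩
  | mul a b _ _ ha hb =>
    obtain ⟨n, hn⟩ := ha
    obtain ⟨m, hm⟩ := hb
    exact ⟨m + n, powFilt_mul_powFilt had hn hm⟩

end Filtration

/-! ### Products with 1 ⊗ x in H ⊗ H -/

section Tensor

variable {k : Type u} {H : Type v} [Field k] [Ring H] [Algebra k H]

theorem one_tmul_mul_mem {V W : Submodule k H} {x : H} (h : ∀ a ∈ V, x * a ∈ W) {t : H ⊗[k] H}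
    (ht : t ∈ tensorSub ⊤ V) : (1 ⊗ₜ[k] x) * t ∈ tensorSub ⊤ W := by
  have : tensorSub ⊤ V ≤ (tensorSub ⊤ W).comap (LinearMap.mulLeft k ((1 : H) ⊗ₜ[k] x)) :=
    tensorSub_le fun a ha b hb => by
      simpa using tmul_mem_tensorSub ha (h b hb)
  exact this ht

theorem mul_one_tmul_mem {V W : Submodule k H} {x : H} (h : ∀ a ∈ V, a * x ∈ W) {t : H ⊗[k] H}
    (ht : t ∈ tensorSub ⊤ V) : t * (1 ⊗ₜ[k] x) ∈ tensorSub ⊤ W := by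
  have : tensorSub ⊤ V ≤ (tensorSub ⊤ W).comap (LinearMap.mulRight k ((1 : H) ⊗ₜ[k] x)) :=
    tensorSub_le fun a ha b hb => by
      simpa using tmul_mem_tensorSub ha (h b hb)
  exact this ht

theorem one_tmul_commutator_mem {V W : Submodule k H} {x : H} (h : ∀ a ∈ V, x * a - a * x ∈ W)
    {t : H ⊗[k] H} (ht : t ∈ tensorSub ⊤ V) :
    (1 ⊗ₜ[k] x) * t - t * (1 ⊗ₜ[k] x) ∈ tensorSub ⊤ W := by
  have : tensorSub ⊤ V ≤ (tensorSub ⊤ W).comap (LinearMap.mulLeft k ((1 : H) ⊗ₜ[k] x) -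
      LinearMap.mulRight k ((1 : H) ⊗ₜ[k] x)) :=
    tensorSub_le fun a ha b hb => by
      simpa [TensorProduct.tmul_sub] using tmul_mem_tensorSub ha (h b hb)
  exact this ht

/-- `H ⊗ M` as a subalgebra of `H ⊗ H`. -/
noncomputable def tensorSubalgebra (M : Subalgebra k H) : Subalgebra k (H ⊗[k] H) :=
  (tensorSub ⊤ (Subalgebra.toSubmodule M)).toSubalgebra
    (tmul_mem_tensorSub trivial (one_mem M))
    fun _ _ hs ht => mul_mem_tensorSub_top (fun _ ha _ hb => M.mul_mem ha hb) hs ht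

/-- `a ⊗ b ↦ ε(b) a`. -/
noncomputable def rightSlice (f : Module.Dual k H) : H ⊗[k] H →ₗ[k] H :=
  (TensorProduct.rid k H).toLinearMap ∘ₗ LinearMap.lTensor H f

@[simp] theorem rightSlice_tmul (f : Module.Dual k H) (a b : H) :
    rightSlice f (a ⊗ₜ[k] b) = f b • a := by
  simp [rightSlice]

theorem rightSlice_eq_zero {V : Submodule k H} {f : Module.Dual k H} (hf : ∀ a ∈ V, f a = 0)
    {t : H ⊗[k] H} (ht : t ∈ tensorSub ⊤ V) : rightSlice f t = 0 := by
  have : tensorSub ⊤ V ≤ LinearMap.ker (rightSlice f) :=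
    tensorSub_le fun a _ b hb => by simp [hf b hb]
  exact this ht

end Tensor

/-! ### Freeness of an Ore step -/

section Free

variable {k : Type u} {H : Type v} [Field k] [Ring H] [Algebra k H]
variable {Γ : Type w} [AddCommMonoid Γ] [LinearOrder Γ]
variable (𝒜 : Γ → Submodule k H) [GradedAlgebra 𝒜]

/-- The properties of the comultiplication of a connected graded bialgebra used to study its
left coideals; the co-opposite of such a comultiplication has them as well. -/
structure IsConnectedComul (Δ : H →ₐ[k] H ⊗[k] H) (ε : Module.Dual k H) : Prop where
  comul_sub_mem : ∀ γ, ∀ y ∈ 𝒜 γ, Δ y - 1 ⊗ₜ[k] y ∈ tensorSub ⊤ (⨆ β : Set.Iio γ, 𝒜 β)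
  rightSlice_comul : ∀ y, rightSlice ε (Δ y) = y
  counit_one : ε 1 = 1
  counit_eq_zero : ∀ γ, γ ≠ 0 → ∀ y ∈ 𝒜 γ, ε y = 0
  connected : ∀ y ∈ 𝒜 0, ∃ c : k, y = c • (1 : H)

/-- `E` is a homogeneous left coideal subalgebra normalized by the homogeneous element `x ∉ E`,
which is primitive modulo `E`. -/
structure IsOreStep (Δ : H →ₐ[k] H ⊗[k] H) (E : Subalgebra k H) (x : H) (d : Γ) : Prop where
  isHom : IsHom 𝒜 (Subalgebra.toSubmodule E)
  coideal : ∀ a ∈ E, Δ a ∈ tensorSub ⊤ (Subalgebra.toSubmodule E)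
  mem_deg : x ∈ 𝒜 d
  ad_mem : ∀ a ∈ E, x * a - a * x ∈ E
  notMem : x ∉ E
  comul_sub_mem : Δ x - 1 ⊗ₜ[k] x ∈ tensorSub ⊤ (Subalgebra.toSubmodule E)

variable {𝒜} {Δ : H →ₐ[k] H ⊗[k] H} {ε : Module.Dual k H} {E : Subalgebra k H} {x : H} {d : Γ}

theorem isHom_powFilt (hE : IsHom 𝒜 (Subalgebra.toSubmodule E)) (hx : x ∈ 𝒜 d) (n : ℕ) :
    IsHom 𝒜 (powFilt E x n) := by
  intro a ha γ
  have : powFilt E x n ≤ (powFilt E x n).comap (GradedAlgebra.proj 𝒜 γ) :=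
    powFilt_le fun i hi => by
      refine hE.le_of_homogeneous (Q := ((powFilt E x n).comap (GradedAlgebra.proj 𝒜 γ)).comap
        (LinearMap.mulRight k (x ^ i))) fun β e he hβ => ?_
      exact proj_mem_of_mem 𝒜 (SetLike.GradedMul.mul_mem hβ (SetLike.pow_mem_graded i hx))
        fun _ => powFilt_mono (Nat.succ_le_of_lt hi) (mul_pow_mem_powFilt he i)
  exact this ha

theorem IsOreStep.ne_zero (h : IsOreStep 𝒜 Δ E x d) (hΔ : IsConnectedComul 𝒜 Δ ε) : d ≠ 0 := by
  rintro rfl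
  obtain ⟨c, rfl⟩ := hΔ.connected x h.mem_deg
  exact h.notMem (E.smul_mem (one_mem E) c)

theorem IsOreStep.comul_pow_mem (h : IsOreStep 𝒜 Δ E x d) (n : ℕ) :
    Δ x ^ n ∈ tensorSub ⊤ (powFilt E x (n + 1)) := by
  induction n with
  | zero => exact one_tmul_mem_tensorSub (mem_powFilt_one (one_mem E))
  | succ n ih =>
    have e : Δ x ^ (n + 1) = (1 ⊗ₜ[k] x) * Δ x ^ n + (Δ x - 1 ⊗ₜ[k] x) * Δ x ^ n := by
      rw [pow_succ']
      noncomm_ring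
    rw [e]
    refine add_mem (one_tmul_mul_mem (fun a ha => self_mul_powFilt h.ad_mem ha) ih) ?_
    exact mul_mem_tensorSub_top (fun a ha b hb =>
      powFilt_le_succ _ (mul_mem_powFilt_of_mem_left ha hb)) h.comul_sub_mem ih

theorem IsOreStep.comul_powFilt_mem (h : IsOreStep 𝒜 Δ E x d) {n : ℕ} {a : H}
    (ha : a ∈ powFilt E x n) : Δ a ∈ tensorSub ⊤ (powFilt E x n) := by
  have : powFilt E x n ≤ (tensorSub ⊤ (powFilt E x n)).comap Δ.toLinearMap :=
    powFilt_le fun i hi e he => by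
      have := mul_mem_tensorSub_top (W := powFilt E x n) (fun a ha b hb =>
        powFilt_mono (Nat.succ_le_of_lt hi) (mul_mem_powFilt_of_mem_left ha hb))
        (h.coideal e he) (h.comul_pow_mem i)
      simpa using this
  exact this ha

/-- The first two terms of the binomial expansion of (1 ⊗ x + t)^(n+1), where t ∈ H ⊗ E. Products of
several t's and commutators of 1 ⊗ x with t fall into lower powers of x. -/
theorem IsOreStep.comul_pow_succ_sub_mem (h : IsOreStep 𝒜 Δ E x d) (n : ℕ) :
    Δ x ^ (n + 1) - 1 ⊗ₜ[k] (x ^ (n + 1)) -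
      ((n + 1 : ℕ) : k) • ((Δ x - 1 ⊗ₜ[k] x) * (1 ⊗ₜ[k] (x ^ n))) ∈ tensorSub ⊤ (powFilt E x n) := by
  have hX : ∀ m : ℕ, (1 : H) ⊗ₜ[k] (x ^ m) = (1 ⊗ₜ[k] x) ^ m := fun m => by
    simp [Algebra.TensorProduct.tmul_pow]
  obtain ⟨t, ht⟩ : ∃ t, Δ x = 1 ⊗ₜ[k] x + t := ⟨_, (add_sub_cancel _ _).symm⟩
  have htE : t ∈ tensorSub ⊤ (Subalgebra.toSubmodule E) := by simpa [ht] using h.comul_sub_mem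
  induction n with
  | zero =>
    have : t * ((1 : H) ⊗ₜ[k] (1 : H)) = t := mul_one t
    simp [ht, this]
  | succ n ih =>
    have hR := add_mem (one_tmul_mul_mem (fun a ha => self_mul_powFilt h.ad_mem ha) ih)
      (mul_mem_tensorSub_top (fun a ha b hb => powFilt_le_succ n
        (mul_mem_powFilt_of_mem_left (x := x) ha hb)) htE ih)
    have hpow : ∀ s ∈ tensorSub ⊤ (Subalgebra.toSubmodule E),
        s * (1 ⊗ₜ[k] (x ^ n)) ∈ tensorSub ⊤ (powFilt E x (n + 1)) := fun s hs =>
      mul_one_tmul_mem (fun a ha => mul_pow_mem_powFilt ha n) hs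
    have h1 := hpow _ (one_tmul_commutator_mem h.ad_mem htE)
    have h2 := hpow _ (mul_mem_tensorSub_top (fun a ha b hb => E.mul_mem ha hb) htE htE)
    have := add_mem hR (Submodule.smul_mem _ ((n + 1 : ℕ) : k) (add_mem h1 h2))
    convert this using 1
    simp only [ht, hX, add_sub_cancel_left]
    generalize (1 : H) ⊗ₜ[k] x = X
    rw [pow_succ' _ (n + 1), pow_succ' X (n + 1), pow_succ' X n]
    simp only [add_mul, mul_sub, sub_mul, mul_smul_comm, mul_assoc]
    push_cast
    module

theorem IsOreStep.comul_pow_sub_mem (h : IsOreStep 𝒜 Δ E x d) (n : ℕ) :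
    Δ x ^ n - 1 ⊗ₜ[k] (x ^ n) ∈ tensorSub ⊤ (powFilt E x n) := by
  cases n with
  | zero => simp [← Algebra.TensorProduct.one_def]
  | succ n =>
    have h1 := h.comul_pow_succ_sub_mem n
    have h2 : (Δ x - 1 ⊗ₜ[k] x) * (1 ⊗ₜ[k] (x ^ n)) ∈ tensorSub ⊤ (powFilt E x (n + 1)) :=
      mul_one_tmul_mem (fun a ha => mul_pow_mem_powFilt ha n) h.comul_sub_mem
    have := add_mem (tensorSub_mono le_rfl (powFilt_le_succ n) h1)
      (Submodule.smul_mem _ ((n + 1 : ℕ) : k) h2)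
    simpa using this

theorem IsConnectedComul.proj_zero (hΔ : IsConnectedComul 𝒜 Δ ε) (y : H) :
    GradedAlgebra.proj 𝒜 0 y = ε y • (1 : H) := by
  refine homogeneous_induction (𝒜 := 𝒜) (Q := LinearMap.eqLocus (GradedAlgebra.proj 𝒜 0)
    (ε.smulRight (1 : H))) (fun γ y hy => ?_) y
  rw [LinearMap.mem_eqLocus, LinearMap.smulRight_apply]
  by_cases h : γ = 0
  · subst h
    rw [proj_of_mem_same 𝒜 hy]
    obtain ⟨c, rfl⟩ := hΔ.connected y hy
    simp [hΔ.counit_one]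
  · rw [proj_of_mem_ne 𝒜 hy h, hΔ.counit_eq_zero γ h y hy, zero_smul]

variable [IsOrderedCancelAddMonoid Γ]

/-- If `e x ^ n` lies in `∑_{i < n} E x ^ i` for a nonzero `e ∈ E`, then so does `x ^ n`. -/
theorem IsOreStep.pow_mem_of_mul_pow_mem (hΔ : IsConnectedComul 𝒜 Δ ε) (h : IsOreStep 𝒜 Δ E x d)
    {n : ℕ} {e : H} (he : e ∈ E) (hmem : e * x ^ n ∈ powFilt E x n) (h0 : e ≠ 0) :
    x ^ n ∈ powFilt E x n := by
  -- I consists of the possible leading coefficients in degree n. It is a left coideal since Δ(x)^n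
  -- is 1 ⊗ x^n modulo lower powers.
  let I : Submodule k H :=
    Subalgebra.toSubmodule E ⊓ (powFilt E x n).comap (LinearMap.mulRight k (x ^ n))
  have hI : ∀ a ∈ I, Δ a ∈ tensorSub ⊤ I := by
    rintro a ⟨haE, ha⟩
    rw [mem_tensorSub_top_iff]
    refine fun f => ⟨slice_mem_of_mem (h.coideal a haE) f, ?_⟩
    have h1 : Δ a * Δ x ^ n ∈ tensorSub ⊤ (powFilt E x n) := by
      simpa using h.comul_powFilt_mem ha
    have h5 := sub_mem h1 (mul_mem_tensorSub_top (fun a ha b hb =>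
      mul_mem_powFilt_of_mem_left (x := x) ha hb) (h.coideal a haE) (h.comul_pow_sub_mem n))
    rw [← mul_sub, sub_sub_cancel] at h5
    have := slice_mem_of_mem h5 f
    rwa [slice_mul_one_tmul] at this
  -- A left coideal inside ker ε is zero, because (id ⊗ ε)Δ = id.
  obtain ⟨a, ha, hεa⟩ : ∃ a ∈ I, ε a ≠ 0 := by
    by_contra! hcon
    have := rightSlice_eq_zero hcon (hI e ⟨he, hmem⟩)
    rw [hΔ.rightSlice_comul] at this
    exact h0 this
  -- The component of degree n • d replaces the coefficient a by its degree 0 part, the nonzero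
  -- scalar ε(a).
  have hproj : GradedAlgebra.proj 𝒜 (n • d) (a * x ^ n) = GradedAlgebra.proj 𝒜 0 a * x ^ n := by
    refine homogeneous_induction (𝒜 := 𝒜) (Q := LinearMap.eqLocus
      (GradedAlgebra.proj 𝒜 (n • d) ∘ₗ LinearMap.mulRight k (x ^ n))
      (LinearMap.mulRight k (x ^ n) ∘ₗ GradedAlgebra.proj 𝒜 0)) (fun γ y hy => ?_) a
    have hm := SetLike.GradedMul.mul_mem hy (SetLike.pow_mem_graded n h.mem_deg)
    simp only [LinearMap.mem_eqLocus, LinearMap.comp_apply, LinearMap.mulRight_apply]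
    by_cases hγ : γ = 0
    · subst hγ
      rw [proj_of_mem_same 𝒜 hy]
      rw [zero_add] at hm
      exact proj_of_mem_same 𝒜 hm
    · rw [proj_of_mem_ne 𝒜 hy hγ, proj_of_mem_ne 𝒜 hm (by simpa using hγ), zero_mul]
  have := isHom_powFilt h.isHom h.mem_deg n _ ha.2 (n • d)
  rw [LinearMap.mulRight_apply, hproj, hΔ.proj_zero, smul_mul_assoc, one_mul] at this
  exact (Submodule.smul_mem_iff _ hεa).1 this

/-- The powers of `x` are linearly independent over `E`. -/
theorem IsOreStep.eq_zero_of_mul_pow_mem [CharZero k] (hΔ : IsConnectedComul 𝒜 Δ ε)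
    (h : IsOreStep 𝒜 Δ E x d) (n : ℕ) : ∀ e ∈ E, e * x ^ n ∈ powFilt E x n → e = 0 := by
  induction n with
  | zero =>
    intro e _ hmem
    simpa [powFilt] using hmem
  | succ m ih =>
    intro e he hmem
    by_contra h0
    obtain ⟨f, hf, y, hy, hfy⟩ := mem_powFilt_succ.1 (h.pow_mem_of_mul_pow_mem hΔ he hmem h0)
    let c : k := ((m + 1 : ℕ) : k)
    have hc : c ≠ 0 := by
      simp only [c]
      exact_mod_cast m.succ_ne_zero
    -- From x^(m+1) = f + y x^m, this is the coefficient of 1 ⊗ x^m in Δ(x^(m+1)) - Δ(f + y x^m),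
    -- modulo lower powers.
    let t := 1 ⊗ₜ[k] y + c • (Δ x - 1 ⊗ₜ[k] x) - Δ y
    have htE : t ∈ tensorSub ⊤ (Subalgebra.toSubmodule E) :=
      sub_mem (add_mem (one_tmul_mem_tensorSub hy) (Submodule.smul_mem _ c h.comul_sub_mem))
        (h.coideal y hy)
    have ht : t * (1 ⊗ₜ[k] (x ^ m)) ∈ tensorSub ⊤ (powFilt E x m) := by
      have h1 := h.comul_pow_succ_sub_mem m
      have h2 := h.comul_powFilt_mem hf
      have h3 := one_tmul_mem_tensorSub hf
      have h4 : Δ y * (Δ x ^ m - 1 ⊗ₜ[k] (x ^ m)) ∈ tensorSub ⊤ (powFilt E x m) :=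
        mul_mem_tensorSub_top (fun a ha b hb =>
          mul_mem_powFilt_of_mem_left (x := x) ha hb) (h.coideal y hy) (h.comul_pow_sub_mem m)
      have h5 := sub_mem (sub_mem (add_mem h2 h4) h1) h3
      convert h5 using 1
      rw [← map_pow Δ x (m + 1), ← hfy]
      simp only [map_add, map_mul, map_pow, TensorProduct.tmul_add]
      have : (1 : H) ⊗ₜ[k] (y * x ^ m) = (1 ⊗ₜ[k] y) * (1 ⊗ₜ[k] (x ^ m)) := by simp
      rw [this]
      simp only [t, c, mul_sub, sub_mul, add_mul, smul_mul_assoc]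
      abel
    have ht0 : t = 0 := eq_zero_of_slice_eq_zero fun f => by
      refine ih _ (slice_mem_of_mem htE f) ?_
      rw [← slice_mul_one_tmul]
      exact slice_mem_of_mem ht f
    -- Applying id ⊗ ε to t = 0 gives c(x - ε(x)) = y - ε(y) ∈ E, and c = m + 1 is invertible.
    have h6 := congrArg (rightSlice ε) ht0
    simp only [t, map_sub, map_add, map_smul, rightSlice_tmul, hΔ.rightSlice_comul, map_zero] at h6
    refine h.notMem ?_
    have h7 : x = ε x • (1 : H) + c⁻¹ • (y - ε y • (1 : H)) := by
      have : c • (x - ε x • (1 : H)) = y - ε y • (1 : H) := by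
        rw [← sub_eq_zero, ← h6]
        abel
      rw [← this, inv_smul_smul₀ hc]
      abel
    rw [h7]
    exact add_mem (E.smul_mem (one_mem E) _)
      (E.smul_mem (sub_mem hy (E.smul_mem (one_mem E) _)) _)

end Free

/-! ### Closure of a subalgebra under [x, -] -/

section AdClosure

variable {k : Type u} {H : Type v} [Field k] [Ring H] [Algebra k H]

/-- The smallest subalgebra containing `C` and stable under `[x, -]`. -/
def adClosure (C : Subalgebra k H) (x : H) : Subalgebra k H :=
  sInf {K | C ≤ K ∧ ∀ a ∈ K, x * a - a * x ∈ K}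

variable {C K : Subalgebra k H} {x : H}

theorem adClosure_le (hC : C ≤ K) (hx : ∀ a ∈ K, x * a - a * x ∈ K) : adClosure C x ≤ K :=
  sInf_le ⟨hC, hx⟩

theorem le_adClosure : C ≤ adClosure C x := le_sInf fun _ h => h.1

theorem ad_mem_adClosure {a : H} (ha : a ∈ adClosure C x) : x * a - a * x ∈ adClosure C x := by
  rw [adClosure, Algebra.mem_sInf] at ha ⊢
  exact fun K hK => hK.2 a (ha K hK)

theorem adClosure_le_adjoin : adClosure C x ≤ Algebra.adjoin k ((C : Set H) ∪ {x}) := by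
  refine adClosure_le (fun a ha => Algebra.subset_adjoin (Or.inl ha)) fun a ha => ?_
  have hx : x ∈ Algebra.adjoin k ((C : Set H) ∪ {x}) := Algebra.subset_adjoin (Or.inr rfl)
  exact sub_mem (mul_mem hx ha) (mul_mem ha hx)

theorem adClosure_induction {P : Subalgebra k H} (hC : C ≤ P)
    (h : ∀ a ∈ adClosure C x, a ∈ P → x * a - a * x ∈ P) : adClosure C x ≤ P := by
  have : adClosure C x ≤ adClosure C x ⊓ P :=
    adClosure_le (le_inf le_adClosure hC) fun a ha => ⟨ad_mem_adClosure ha.1, h a ha.1 ha.2⟩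
  exact this.trans inf_le_right

/-- Passing to the closure before adjoining x yields nothing beyond C[x], so the closure can be
inserted between C and C[x]. -/
theorem adjoin_adClosure_le :
    Algebra.adjoin k ((adClosure C x : Set H) ∪ {x}) ≤ Algebra.adjoin k ((C : Set H) ∪ {x}) := by
  refine Algebra.adjoin_le (Set.union_subset adClosure_le_adjoin ?_)
  exact fun y hy => Algebra.subset_adjoin (Or.inr hy)

end AdClosure

/-! ### Coideal subalgebras from generators -/

section Coideal

variable {k : Type u} {H : Type v} [Field k] [Ring H] [Algebra k H]
variable {Δ : H →ₐ[k] H ⊗[k] H}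

theorem comul_mem_adjoin {S : Set H}
    (h : ∀ a ∈ S, Δ a ∈ tensorSub ⊤ (Subalgebra.toSubmodule (Algebra.adjoin k S))) :
    ∀ a ∈ Algebra.adjoin k S, Δ a ∈ tensorSub ⊤ (Subalgebra.toSubmodule (Algebra.adjoin k S)) :=
  fun _ ha => Algebra.adjoin_le (S := (tensorSubalgebra (Algebra.adjoin k S)).comap Δ) h ha

theorem comul_mem_of_sub_mem {K : Subalgebra k H} {x : H} (hx : x ∈ K)
    (h : Δ x - 1 ⊗ₜ[k] x ∈ tensorSub ⊤ (Subalgebra.toSubmodule K)) :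
    Δ x ∈ tensorSub ⊤ (Subalgebra.toSubmodule K) := by
  have := add_mem h (one_tmul_mem_tensorSub (V := Subalgebra.toSubmodule K) hx)
  rwa [sub_add_cancel] at this

theorem comul_mem_adjoin_union {C : Subalgebra k H}
    (hC : ∀ a ∈ C, Δ a ∈ tensorSub ⊤ (Subalgebra.toSubmodule C)) {S : Set H}
    (hS : ∀ a ∈ S, Δ a - 1 ⊗ₜ[k] a ∈
      tensorSub ⊤ (Subalgebra.toSubmodule (Algebra.adjoin k ((C : Set H) ∪ S)))) :
    ∀ a ∈ Algebra.adjoin k ((C : Set H) ∪ S),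
      Δ a ∈ tensorSub ⊤ (Subalgebra.toSubmodule (Algebra.adjoin k ((C : Set H) ∪ S))) := by
  refine comul_mem_adjoin fun a ha => ?_
  rcases ha with ha | ha
  · have hle : C ≤ Algebra.adjoin k ((C : Set H) ∪ S) := fun b hb =>
      Algebra.subset_adjoin (Or.inl hb)
    exact tensorSub_mono le_rfl hle (hC a ha)
  · exact comul_mem_of_sub_mem (Algebra.subset_adjoin (Or.inr ha)) (hS a ha)

/-- With Δ(x) = 1 ⊗ x + t one has Δ([x, a]) = [1 ⊗ x, Δ(a)] + [t, Δ(a)], and both terms stay in H ⊗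
`adClosure C x`. -/
theorem comul_mem_adClosure {C : Subalgebra k H} {x : H}
    (hC : ∀ a ∈ C, Δ a ∈ tensorSub ⊤ (Subalgebra.toSubmodule C))
    (hx : Δ x - 1 ⊗ₜ[k] x ∈ tensorSub ⊤ (Subalgebra.toSubmodule C)) :
    ∀ a ∈ adClosure C x, Δ a ∈ tensorSub ⊤ (Subalgebra.toSubmodule (adClosure C x)) := by
  have hle : tensorSub ⊤ (Subalgebra.toSubmodule C) ≤
      tensorSub ⊤ (Subalgebra.toSubmodule (adClosure C x)) := tensorSub_mono le_rfl le_adClosure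
  have hM : adClosure C x ≤ (tensorSubalgebra (adClosure C x)).comap Δ := by
    refine adClosure_induction (fun a ha => hle (hC a ha)) fun a _ ha => ?_
    obtain ⟨t, ht⟩ : ∃ t, Δ x = 1 ⊗ₜ[k] x + t := ⟨_, (add_sub_cancel _ _).symm⟩
    have htM : t ∈ tensorSubalgebra (adClosure C x) := hle (by simpa [ht] using hx)
    have h1 : (1 ⊗ₜ[k] x) * Δ a - Δ a * (1 ⊗ₜ[k] x) ∈ tensorSubalgebra (adClosure C x) :=
      one_tmul_commutator_mem (fun b hb => ad_mem_adClosure hb) ha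
    have h2 : (1 ⊗ₜ[k] x) * Δ a - Δ a * (1 ⊗ₜ[k] x) + (t * Δ a - Δ a * t) ∈
        tensorSubalgebra (adClosure C x) := add_mem h1 (sub_mem (mul_mem htM ha) (mul_mem ha htM))
    rw [Subalgebra.mem_comap, map_sub, map_mul, map_mul, ht]
    convert h2 using 1
    noncomm_ring
  exact fun a ha => hM ha

end Coideal

/-! ### Refining an inclusion of coideal subalgebras -/

section Pairs

variable {k : Type u} {H : Type v} [Field k] [Ring H] [Algebra k H]
variable {Γ : Type w} [AddCommMonoid Γ] [LinearOrder Γ]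
variable (𝒜 : Γ → Submodule k H) [GradedAlgebra 𝒜]

/-- A well order on pairs consisting of a degree and an element, comparing degrees first. -/
def degPrec : Γ × H → Γ × H → Prop := Prod.Lex (· < ·) WellOrderingRel

instance [WellFoundedLT Γ] : IsWellOrder (Γ × H) degPrec := by
  unfold degPrec
  infer_instance

/-- The subalgebra generated by `C` and the homogeneous elements of `D` preceding `p`. -/
def lowerPart (C D : Subalgebra k H) (p : Γ × H) : Subalgebra k H :=
  Algebra.adjoin k ((C : Set H) ∪ {y | y ∈ D ∧ ∃ β, y ∈ 𝒜 β ∧ degPrec (β, y) p})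

/-- `C ⊆ D` are homogeneous left coideal subalgebras which differ only in degrees strictly
above `δ`, in the divisibility order of `Γ`. -/
structure IsCoidealPair (Δ : H →ₐ[k] H ⊗[k] H) (δ : Γ) (C D : Subalgebra k H) : Prop where
  le : C ≤ D
  homC : IsHom 𝒜 (Subalgebra.toSubmodule C)
  homD : IsHom 𝒜 (Subalgebra.toSubmodule D)
  coidealC : ∀ a ∈ C, Δ a ∈ tensorSub ⊤ (Subalgebra.toSubmodule C)
  coidealD : ∀ a ∈ D, Δ a ∈ tensorSub ⊤ (Subalgebra.toSubmodule D)
  degree : ∀ γ, ∀ a ∈ D, a ∈ 𝒜 γ → a ∉ C → ∃ ε, ε ≠ 0 ∧ γ = δ + ε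

/-- `p` consists of a homogeneous element of `D` and its degree. -/
def IsCandidate (D : Subalgebra k H) (p : Γ × H) : Prop := p.2 ∈ D ∧ p.2 ∈ 𝒜 p.1

variable {𝒜} {Δ : H →ₐ[k] H ⊗[k] H} {ε : Module.Dual k H} {C D : Subalgebra k H} {p q : Γ × H}
variable {δ : Γ}

theorem le_lowerPart : C ≤ lowerPart 𝒜 C D p := fun _ ha => Algebra.subset_adjoin (Or.inl ha)

theorem lowerPart_le (h : C ≤ D) : lowerPart 𝒜 C D p ≤ D :=
  Algebra.adjoin_le (Set.union_subset h fun _ hy => hy.1)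

theorem mem_lowerPart_of_prec (hq : IsCandidate 𝒜 D q) (h : degPrec q p) : q.2 ∈ lowerPart 𝒜 C D p :=
  Algebra.subset_adjoin (Or.inr ⟨hq.1, q.1, hq.2, h⟩)

theorem mem_lowerPart_of_lt {β : Γ} {y : H} (hy : y ∈ D) (hβ : y ∈ 𝒜 β) (h : β < p.1) :
    y ∈ lowerPart 𝒜 C D p :=
  mem_lowerPart_of_prec (q := (β, y)) ⟨hy, hβ⟩ (Prod.Lex.left _ _ h)

theorem isHom_lowerPart (hC : IsHom 𝒜 (Subalgebra.toSubmodule C)) :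
    IsHom 𝒜 (Subalgebra.toSubmodule (lowerPart 𝒜 C D p)) :=
  isHom_adjoin_union hC fun _ hx => hx.2.imp fun _ h => h.1

theorem adjoin_lowerPart_le_lowerPart [WellFoundedLT Γ] (hq : IsCandidate 𝒜 D q) (h : degPrec q p) :
    Algebra.adjoin k ((lowerPart 𝒜 C D q : Set H) ∪ {q.2}) ≤ lowerPart 𝒜 C D p := by
  refine Algebra.adjoin_le (Set.union_subset (Algebra.adjoin_mono ?_) ?_)
  · refine Set.union_subset_union_right _ fun y hy => ⟨hy.1, ?_⟩
    obtain ⟨β, hβ, hlt⟩ := hy.2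
    exact ⟨β, hβ, _root_.trans hlt h⟩
  · rintro _ rfl
    exact mem_lowerPart_of_prec hq h

theorem adjoin_lowerPart_le (h : C ≤ D) (hp : IsCandidate 𝒜 D p) :
    Algebra.adjoin k ((lowerPart 𝒜 C D p : Set H) ∪ {p.2}) ≤ D :=
  Algebra.adjoin_le (Set.union_subset (lowerPart_le h) (by simpa using hp.1))

/-- An element of `lowerPart 𝒜 C D p` already involves only finitely many, hence a largest, generator. -/
theorem mem_lowerPart_cases [WellFoundedLT Γ] {a : H} (ha : a ∈ lowerPart 𝒜 C D p) :
    a ∈ C ∨ ∃ q, IsCandidate 𝒜 D q ∧ degPrec q p ∧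
      a ∈ Algebra.adjoin k ((lowerPart 𝒜 C D q : Set H) ∪ {q.2}) := by
  have hmono : ∀ q r : Γ × H, IsCandidate 𝒜 D q → (degPrec q r ∨ q = r) →
      Algebra.adjoin k ((lowerPart 𝒜 C D q : Set H) ∪ {q.2}) ≤
        Algebra.adjoin k ((lowerPart 𝒜 C D r : Set H) ∪ {r.2}) := by
    rintro q r hq (h | rfl)
    · exact (adjoin_lowerPart_le_lowerPart hq h).trans fun b hb => Algebra.subset_adjoin (Or.inl hb)
    · exact le_rfl
  have hCq : ∀ q, C ≤ Algebra.adjoin k ((lowerPart 𝒜 C D q : Set H) ∪ {q.2}) := fun q b hb =>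
    Algebra.subset_adjoin (Or.inl (le_lowerPart hb))
  -- Sums and products are treated together: the larger of the two bounding candidates serves for
  -- both operands.
  have hjoin : ∀ op : H → H → H, (∀ K : Subalgebra k H, ∀ a ∈ K, ∀ b ∈ K, op a b ∈ K) → ∀ a b,
      (a ∈ C ∨ ∃ q, IsCandidate 𝒜 D q ∧ degPrec q p ∧
        a ∈ Algebra.adjoin k ((lowerPart 𝒜 C D q : Set H) ∪ {q.2})) →
      (b ∈ C ∨ ∃ q, IsCandidate 𝒜 D q ∧ degPrec q p ∧
        b ∈ Algebra.adjoin k ((lowerPart 𝒜 C D q : Set H) ∪ {q.2})) →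
      (op a b ∈ C ∨ ∃ q, IsCandidate 𝒜 D q ∧ degPrec q p ∧
        op a b ∈ Algebra.adjoin k ((lowerPart 𝒜 C D q : Set H) ∪ {q.2})) := by
    rintro op hop a b (ha | ⟨q, hq, hqp, ha⟩) (hb | ⟨r, hr, hrp, hb⟩)
    · exact Or.inl (hop C a ha b hb)
    · exact Or.inr ⟨r, hr, hrp, hop _ a (hCq r ha) b hb⟩
    · exact Or.inr ⟨q, hq, hqp, hop _ a ha b (hCq q hb)⟩
    · rcases trichotomous_of degPrec q r with h | h | h
      · exact Or.inr ⟨r, hr, hrp, hop _ a (hmono q r hq (Or.inl h) ha) b hb⟩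
      · exact Or.inr ⟨r, hr, hrp, hop _ a (hmono q r hq (Or.inr h) ha) b hb⟩
      · exact Or.inr ⟨q, hq, hqp, hop _ a ha b (hmono r q hr (Or.inl h) hb)⟩
  induction ha using Algebra.adjoin_induction with
  | mem a ha =>
    rcases ha with ha | ⟨haD, β, hβ, h⟩
    · exact Or.inl ha
    · exact Or.inr ⟨(β, a), ⟨haD, hβ⟩, h, Algebra.subset_adjoin (Or.inr rfl)⟩
  | algebraMap r => exact Or.inl (C.algebraMap_mem r)
  | add a b _ _ ha hb => exact hjoin (· + ·) (fun K a ha b hb => K.add_mem ha hb) a b ha hb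
  | mul a b _ _ ha hb => exact hjoin (· * ·) (fun K a ha b hb => K.mul_mem ha hb) a b ha hb

/-- The contractions of Δ(y) - 1 ⊗ y lie in D, as D is a coideal, and have only components of degree
below β, as H is connected. -/
theorem IsConnectedComul.comul_sub_mem_of_le (hΔ : IsConnectedComul 𝒜 Δ ε)
    (hD : IsHom 𝒜 (Subalgebra.toSubmodule D))
    (hcD : ∀ a ∈ D, Δ a ∈ tensorSub ⊤ (Subalgebra.toSubmodule D)) {K : Subalgebra k H} {β : Γ} {y : H}
    (hK : ∀ α < β, ∀ z ∈ D, z ∈ 𝒜 α → z ∈ K) (hy : y ∈ D) (hβ : y ∈ 𝒜 β) :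
    Δ y - 1 ⊗ₜ[k] y ∈ tensorSub ⊤ (Subalgebra.toSubmodule K) := by
  rw [mem_tensorSub_top_iff]
  intro f
  have h1 := slice_mem_of_mem (hΔ.comul_sub_mem β y hβ) f
  have h2 : slice f (Δ y - 1 ⊗ₜ[k] y) ∈ Subalgebra.toSubmodule D := by
    rw [map_sub, slice_tmul]
    exact sub_mem (slice_mem_of_mem (hcD y hy) f) (D.smul_mem hy _)
  refine mem_of_proj_mem 𝒜 fun γ => ?_
  by_cases hγ : γ < β
  · exact hK γ hγ _ (hD _ h2 γ) (proj_mem 𝒜 γ _)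
  · have : (⨆ α : Set.Iio β, 𝒜 α) ≤ LinearMap.ker (GradedAlgebra.proj 𝒜 γ) :=
      iSup_le fun α z hz => proj_of_mem_ne 𝒜 hz fun e => hγ (e ▸ α.2)
    rw [LinearMap.mem_ker.1 (this h1)]
    exact zero_mem _

theorem IsCoidealPair.comul_sub_mem (h : IsCoidealPair 𝒜 Δ δ C D) (hΔ : IsConnectedComul 𝒜 Δ ε)
    {β : Γ} {y : H} (hy : y ∈ D) (hβ : y ∈ 𝒜 β) (hle : β ≤ p.1) :
    Δ y - 1 ⊗ₜ[k] y ∈ tensorSub ⊤ (Subalgebra.toSubmodule (lowerPart 𝒜 C D p)) :=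
  hΔ.comul_sub_mem_of_le h.homD h.coidealD
    (fun _ hα _ hz hzα => mem_lowerPart_of_lt hz hzα (hα.trans_le hle)) hy hβ

theorem IsCoidealPair.coideal_lowerPart (h : IsCoidealPair 𝒜 Δ δ C D) (hΔ : IsConnectedComul 𝒜 Δ ε) :
    ∀ a ∈ lowerPart 𝒜 C D p, Δ a ∈ tensorSub ⊤ (Subalgebra.toSubmodule (lowerPart 𝒜 C D p)) := by
  refine comul_mem_adjoin_union h.coidealC ?_
  rintro y ⟨hy, β, hβ, hlt⟩
  refine h.comul_sub_mem hΔ hy hβ ?_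
  rcases (Prod.lex_def.1 hlt) with h | h
  · exact h.le
  · exact h.1.le

theorem isHom_adClosure (hC : IsHom 𝒜 (Subalgebra.toSubmodule C)) {x : H} {d : Γ} (hx : x ∈ 𝒜 d) :
    IsHom 𝒜 (Subalgebra.toSubmodule (adClosure C x)) := by
  have : adClosure C x ≤ homCore 𝒜 (adClosure C x) := by
    refine adClosure_induction (fun a ha γ => le_adClosure (hC a ha γ)) fun a _ ha γ => ?_
    exact proj_commutator_mem (R := Subalgebra.toSubmodule (adClosure C x)) hx
      fun β _ => ad_mem_adClosure (ha β)
  exact this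

variable [IsOrderedCancelAddMonoid Γ] [WellFoundedLT Γ]

/-- If a < 0, then a + a < a is again negative, against well-foundedness. -/
theorem zero_le_of_wellFounded (a : Γ) : 0 ≤ a := by
  induction a using WellFoundedLT.induction with
  | ind a ih =>
    by_contra h
    rw [not_le] at h
    have := ih (a + a) (by simpa using h)
    exact absurd (this.trans_lt (add_neg h h)) (lt_irrefl _)

theorem add_ne_zero_of_left {a b : Γ} (h : a ≠ 0) : a + b ≠ 0 := fun e => by
  have h1 : 0 < a := lt_of_le_of_ne (zero_le_of_wellFounded a) h.symm
  exact (add_pos_of_pos_of_nonneg h1 (zero_le_of_wellFounded b)).ne' e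

/-- This makes the refinement terminate in each degree: commutators with x only create elements in
degrees d + ε with ε ≠ 0, since the degree 0 part is central. -/
theorem adClosure_degree (hΔ : IsConnectedComul 𝒜 Δ ε) (hC : IsHom 𝒜 (Subalgebra.toSubmodule C))
    {x : H} {d : Γ} (hx : x ∈ 𝒜 d) {γ : Γ} {a : H} (ha : a ∈ adClosure C x) (haγ : a ∈ 𝒜 γ)
    (haC : a ∉ C) : ∃ ε, ε ≠ 0 ∧ γ = d + ε := by
  -- Elements whose components outside the degrees d + ε, ε ≠ 0, lie in C. It is closed under
  -- products because a factor of degree d + ε forces a product degree of the same form.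
  let P : Subalgebra k H :=
    { carrier := {a | ∀ γ, (∀ ε, ε ≠ 0 → γ ≠ d + ε) → GradedAlgebra.proj 𝒜 γ a ∈ C}
      mul_mem' := by
        intro a b ha hb γ hγ
        refine proj_mul_mem (R := Subalgebra.toSubmodule C) fun α β h => ?_
        refine C.mul_mem (ha α fun ε hε e => ?_) (hb β fun ε hε e => ?_)
        · exact hγ (ε + β) (add_ne_zero_of_left hε) (by rw [← h, e, add_assoc])
        · exact hγ (ε + α) (add_ne_zero_of_left hε) (by rw [← h, e, add_comm, add_assoc])
      add_mem' := by
        intro a b ha hb γ hγ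
        rw [map_add]
        exact add_mem (ha γ hγ) (hb γ hγ)
      algebraMap_mem' := fun r γ _ => proj_mem_of_mem 𝒜 (P := Subalgebra.toSubmodule C)
        (algebraMap_mem_zero r) fun _ => C.algebraMap_mem r }
  have hP : adClosure C x ≤ P := by
    refine adClosure_induction (fun a ha γ _ => hC a ha γ) fun a _ _ γ hγ => ?_
    refine proj_commutator_mem (R := Subalgebra.toSubmodule C) hx fun β h => ?_
    have hβ : β = 0 := by
      by_contra h0
      exact hγ β h0 h.symm
    subst hβ
    rw [hΔ.proj_zero, mul_smul_comm, smul_mul_assoc, mul_one, one_mul, sub_self]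
    exact zero_mem _
  by_contra! hcon
  refine haC ?_
  have := hP ha γ hcon
  rwa [proj_of_mem_same 𝒜 haγ] at this

/-- The generator stays outside the closure for degree reasons: new elements of degree exactly deg x
would need deg x = deg x + ε with ε ≠ 0. -/
theorem IsCoidealPair.isOreStep (h : IsCoidealPair 𝒜 Δ δ C D) (hΔ : IsConnectedComul 𝒜 Δ ε)
    (hp : IsCandidate 𝒜 D p) (hnot : p.2 ∉ lowerPart 𝒜 C D p) :
    IsOreStep 𝒜 Δ (adClosure (lowerPart 𝒜 C D p) p.2) p.2 p.1 where
  isHom := isHom_adClosure (isHom_lowerPart h.homC) hp.2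
  coideal := comul_mem_adClosure (h.coideal_lowerPart hΔ) (h.comul_sub_mem hΔ hp.1 hp.2 le_rfl)
  mem_deg := hp.2
  ad_mem := fun _ ha => ad_mem_adClosure ha
  notMem := fun hmem => by
    obtain ⟨ε, hε, e⟩ := adClosure_degree hΔ (isHom_lowerPart h.homC) hp.2 hmem hp.2 hnot
    exact hε (left_eq_add.1 e)
  comul_sub_mem := tensorSub_mono le_rfl (le_adClosure (C := lowerPart 𝒜 C D p))
    (h.comul_sub_mem hΔ hp.1 hp.2 le_rfl)

theorem IsCoidealPair.adClosure (h : IsCoidealPair 𝒜 Δ δ C D) (hΔ : IsConnectedComul 𝒜 Δ ε)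
    (hp : IsCandidate 𝒜 D p) :
    IsCoidealPair 𝒜 Δ p.1 (lowerPart 𝒜 C D p) (adClosure (lowerPart 𝒜 C D p) p.2) where
  le := le_adClosure
  homC := isHom_lowerPart h.homC
  homD := isHom_adClosure (isHom_lowerPart h.homC) hp.2
  coidealC := h.coideal_lowerPart hΔ
  coidealD := comul_mem_adClosure (h.coideal_lowerPart hΔ) (h.comul_sub_mem hΔ hp.1 hp.2 le_rfl)
  degree := fun _ _ ha haγ haC => adClosure_degree hΔ (isHom_lowerPart h.homC) hp.2 ha haγ haC

/-! ### The recursively defined Ore steps -/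

variable (𝒜) in
/-- The Ore steps `E ⊂ E[x]`, `p = (deg x, x)`, of the refinement of `C ⊆ D` obtained by adjoining
the homogeneous elements of `D` to `C` one at a time and refining, recursively, the inclusion of
each intermediate subalgebra in its closure under `[x, -]`. -/
inductive Jump : Subalgebra k H → Subalgebra k H → Subalgebra k H → Γ × H → Prop
  | here {C D : Subalgebra k H} {p : Γ × H} (hp : IsCandidate 𝒜 D p)
      (hnot : p.2 ∉ lowerPart 𝒜 C D p) : Jump C D (adClosure (lowerPart 𝒜 C D p) p.2) p
  | deeper {C D E : Subalgebra k H} {p q : Γ × H} (hp : IsCandidate 𝒜 D p)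
      (hnot : p.2 ∉ lowerPart 𝒜 C D p)
      (h : Jump (lowerPart 𝒜 C D p) (adClosure (lowerPart 𝒜 C D p) p.2) E q) : Jump C D E q

/-- The subalgebra `E[x]`. -/
def extend (E : Subalgebra k H) (x : H) : Subalgebra k H := Algebra.adjoin k ((E : Set H) ∪ {x})

theorem le_extend {E : Subalgebra k H} {x : H} : E ≤ extend E x := fun _ ha =>
  Algebra.subset_adjoin (Or.inl ha)

theorem self_mem_extend {E : Subalgebra k H} {x : H} : x ∈ extend E x :=
  Algebra.subset_adjoin (Or.inr rfl)

variable {E E' : Subalgebra k H} {q' : Γ × H}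

theorem Jump.bounds (hJ : Jump 𝒜 C D E q) (hCD : C ≤ D) : C ≤ E ∧ extend E q.2 ≤ D := by
  induction hJ with
  | here hp hnot =>
    exact ⟨le_lowerPart.trans le_adClosure, adjoin_adClosure_le.trans (adjoin_lowerPart_le hCD hp)⟩
  | deeper hp hnot hJ ih =>
    obtain ⟨h1, h2⟩ := ih le_adClosure
    exact ⟨le_lowerPart.trans h1, (h2.trans adClosure_le_adjoin).trans (adjoin_lowerPart_le hCD hp)⟩

theorem Jump.isOreStep (hΔ : IsConnectedComul 𝒜 Δ ε) (hJ : Jump 𝒜 C D E q) :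
    ∀ δ, IsCoidealPair 𝒜 Δ δ C D → IsOreStep 𝒜 Δ E q.2 q.1 := by
  induction hJ with
  | here hp hnot => exact fun δ h => h.isOreStep hΔ hp hnot
  | deeper hp hnot hJ ih => exact fun δ h => ih _ (h.adClosure hΔ hp)

theorem Jump.exists_candidate (hJ : Jump 𝒜 C D E q) : ∃ p, IsCandidate 𝒜 D p ∧
    lowerPart 𝒜 C D p ≤ E ∧ extend E q.2 ≤ extend (lowerPart 𝒜 C D p) p.2 ∧
    ((E = CoidealPBW.adClosure (lowerPart 𝒜 C D p) p.2 ∧ q = p) ∨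
      Jump 𝒜 (lowerPart 𝒜 C D p) (CoidealPBW.adClosure (lowerPart 𝒜 C D p) p.2) E q) := by
  cases hJ with
  | here hp hnot => exact ⟨q, hp, le_adClosure, adjoin_adClosure_le, Or.inl ⟨rfl, rfl⟩⟩
  | deeper hp hnot hJ =>
    obtain ⟨h1, h2⟩ := hJ.bounds le_adClosure
    exact ⟨_, hp, h1, h2.trans adClosure_le_adjoin, Or.inr hJ⟩

/-- Compare the outermost candidates. If they differ, one step ends before the other begins; if they
agree, a deeper step lies inside the closure, hence below the step that adjoins the candidate, and
two deeper steps are compared recursively. -/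
theorem Jump.comparable (hJ : Jump 𝒜 C D E q) : ∀ {E' : Subalgebra k H} {q' : Γ × H},
    Jump 𝒜 C D E' q' → extend E q.2 ≤ E' ∨ extend E' q'.2 ≤ E ∨ (E = E' ∧ q = q') := by
  induction hJ with
  | @here C D p hp hnot =>
    intro E' q' hJ'
    obtain ⟨p', hp', h1, h2, h3⟩ := hJ'.exists_candidate
    rcases trichotomous_of degPrec p p' with h | h | h
    · exact Or.inl ((adjoin_adClosure_le.trans (adjoin_lowerPart_le_lowerPart hp h)).trans h1)
    · subst h
      rcases h3 with ⟨rfl, rfl⟩ | hJ'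
      · exact Or.inr (Or.inr ⟨rfl, rfl⟩)
      · exact Or.inr (Or.inl (hJ'.bounds le_adClosure).2)
    · exact Or.inr (Or.inl ((h2.trans (adjoin_lowerPart_le_lowerPart hp' h)).trans le_adClosure))
  | @deeper C D E p q hp hnot hJ ih =>
    intro E' q' hJ'
    obtain ⟨p', hp', h1, h2, h3⟩ := hJ'.exists_candidate
    obtain ⟨h4, h5⟩ := hJ.bounds le_adClosure
    rcases trichotomous_of degPrec p p' with h | h | h
    · exact Or.inl (((h5.trans adClosure_le_adjoin).trans
        (adjoin_lowerPart_le_lowerPart hp h)).trans h1)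
    · subst h
      rcases h3 with ⟨rfl, rfl⟩ | hJ'
      · exact Or.inl h5
      · exact ih hJ'
    · exact Or.inr (Or.inl ((h2.trans (adjoin_lowerPart_le_lowerPart hp' h)).trans h4))

end Pairs

/-! ### Ordered monomials and a single distinguished generator -/

section Monomials

variable {k : Type u} {H : Type v} [Field k] [Ring H] [Algebra k H] {Ξ : Type*}

theorem list_prod_map_filter {M : Type*} [Monoid M] (l : List Ξ) (p : Ξ → Bool) (f : Ξ → M)
    (h : ∀ a ∈ l, p a = false → f a = 1) : ((l.filter p).map f).prod = (l.map f).prod := by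
  induction l with
  | nil => rfl
  | cons a l ih =>
    have ih := ih fun b hb => h b (List.mem_cons_of_mem _ hb)
    cases hp : p a with
    | true => simp [hp, ih]
    | false => simp [hp, ih, h a List.mem_cons_self hp]

theorem monomial_eq_of_support_subset (ord : LinearOrder Ξ) (z : Ξ → H) {r : Ξ →₀ ℕ} {s : Finset Ξ}
    (hs : r.support ⊆ s) :
    monomial ord z r = ((s.sort (fun a b => a ≤ b)).map (fun ξ => z ξ ^ r ξ)).prod := by
  classical
  have h : r.support.sort (fun a b => a ≤ b) =
      (s.sort (fun a b => a ≤ b)).filter (fun ξ => decide (ξ ∈ r.support)) := by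
    refine List.Perm.eq_of_pairwise (le := fun a b => a ≤ b)
      (fun a b _ _ h1 h2 => le_antisymm h1 h2) (Finset.pairwise_sort _ _)
      ((Finset.pairwise_sort _ _).filter _) ?_
    refine (List.perm_ext_iff_of_nodup (Finset.sort_nodup _ _)
      ((Finset.sort_nodup _ _).filter _)).2 fun a => ?_
    simp only [Finset.mem_sort, List.mem_filter, decide_eq_true_eq]
    exact ⟨fun h => ⟨hs h, h⟩, fun h => h.2⟩
  rw [monomial, h]
  refine list_prod_map_filter _ _ _ fun a _ ha => ?_
  have : r a = 0 := by simpa using ha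
  rw [this, pow_zero]

@[simp] theorem monomial_zero (ord : LinearOrder Ξ) (z : Ξ → H) : monomial ord z 0 = 1 := by
  simp [monomial]

theorem monomial_mem (ord : LinearOrder Ξ) {z : Ξ → H} {r : Ξ →₀ ℕ} {P : Subalgebra k H}
    (h : ∀ ξ ∈ r.support, z ξ ∈ P) : monomial ord z r ∈ P := by
  refine list_prod_mem fun y hy => ?_
  obtain ⟨ξ, hξ, rfl⟩ := List.mem_map.1 hy
  exact pow_mem (h ξ (by simpa using hξ)) _

/-- Isolates the power of one generator wherever the order places it; no relation between the order
and ξ is needed. -/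
theorem exists_monomial_split (ord : LinearOrder Ξ) {z : Ξ → H} (r : Ξ →₀ ℕ) (ξ : Ξ)
    {P : Subalgebra k H} (h : ∀ η ∈ r.support, η ≠ ξ → z η ∈ P) :
    ∃ a ∈ P, ∃ b ∈ P, monomial ord z r = a * z ξ ^ r ξ * b ∧
      monomial ord z (r.erase ξ) = a * b := by
  classical
  obtain ⟨l₁, l₂, hl⟩ := List.append_of_mem
    ((Finset.mem_sort (fun a b => a ≤ b)).2 (Finset.mem_insert_self ξ r.support))
  have hnd := Finset.sort_nodup (insert ξ r.support) (fun a b => a ≤ b)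
  rw [hl] at hnd
  have hξ : ∀ η, η ∈ l₁ ∨ η ∈ l₂ → η ≠ ξ := by
    rintro η hη rfl
    rw [List.nodup_middle, List.nodup_cons, List.mem_append] at hnd
    exact hnd.1 hη
  have hP : ∀ l : List Ξ, (∀ η ∈ l, η ≠ ξ) → (l.map fun η => z η ^ r η).prod ∈ P := by
    intro l hl
    refine list_prod_mem fun y hy => ?_
    obtain ⟨η, hη, rfl⟩ := List.mem_map.1 hy
    by_cases hr : η ∈ r.support
    · exact pow_mem (h η hr (hl η hη)) _
    · rw [Finsupp.notMem_support_iff.1 hr, pow_zero]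
      exact one_mem P
  have he : ∀ l : List Ξ, (∀ η ∈ l, η ≠ ξ) →
      (l.map fun η => z η ^ r.erase ξ η) = l.map fun η => z η ^ r η := fun l hl =>
    List.map_congr_left fun η hη => by rw [Finsupp.erase_ne (hl η hη)]
  refine ⟨_, hP l₁ fun η hη => hξ η (Or.inl hη), _, hP l₂ fun η hη => hξ η (Or.inr hη), ?_, ?_⟩
  · rw [monomial_eq_of_support_subset ord z (Finset.subset_insert ξ r.support), hl]
    simp [mul_assoc]
  · have hsub : (r.erase ξ).support ⊆ insert ξ r.support := by
      rw [Finsupp.support_erase]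
      exact (Finset.erase_subset _ _).trans (Finset.subset_insert _ _)
    rw [monomial_eq_of_support_subset ord z hsub, hl]
    rw [List.map_append, List.map_cons, he l₁ fun η hη => hξ η (Or.inl hη),
      he l₂ fun η hη => hξ η (Or.inr hη)]
    simp

/-- `act` is left or right multiplication, as a bilinear map in the scalar and the vector. -/
def IsMulAction (act : H →ₗ[k] H →ₗ[k] H) : Prop :=
  act = LinearMap.mul k H ∨ act = (LinearMap.mul k H).flip

variable {act : H →ₗ[k] H →ₗ[k] H} {E : Subalgebra k H}

theorem IsMulAction.mem (h : IsMulAction act) {a b : H} (ha : a ∈ E) (hb : b ∈ E) :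
    act a b ∈ E := by
  rcases h with rfl | rfl
  · exact mul_mem ha hb
  · exact mul_mem hb ha

theorem IsMulAction.apply_one (h : IsMulAction act) (a : H) : act a 1 = a := by
  rcases h with rfl | rfl
  · exact mul_one a
  · exact one_mul a

/-- For left and right coefficients alike, moving x^n to the far right changes only lower powers of
x. This is what makes the order and the side irrelevant. -/
theorem IsMulAction.split (h : IsMulAction act) {x : H} (had : ∀ a ∈ E, x * a - a * x ∈ E)
    {e a b : H} (he : e ∈ E) (ha : a ∈ E) (hb : b ∈ E) (n : ℕ) :
    act e (a * x ^ n * b) - act e (a * b) * x ^ n ∈ powFilt E x n := by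
  rcases h with rfl | rfl
  · have := mul_mem_powFilt_of_mem_left he (mul_pow_mul_sub_mem_powFilt had ha hb n)
    simpa [mul_sub, mul_assoc] using this
  · have := mul_pow_mul_sub_mem_powFilt had ha (mul_mem hb he) n
    simpa [mul_assoc] using this

end Monomials

/-! ### Independence and spanning along a chain of Ore steps -/

section Chains

variable {k : Type u} {H : Type v} [Field k] [Ring H] [Algebra k H] {Ξ : Type*}
variable {Γ : Type w} [AddCommMonoid Γ] [LinearOrder Γ]
variable (𝒜 : Γ → Submodule k H) [GradedAlgebra 𝒜]

/-- A chain of Ore steps `E ξ ⊂ E ξ [z ξ]` above `B`. -/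
structure IsOreChain (Δ : H →ₐ[k] H ⊗[k] H) (B : Subalgebra k H) (E : Ξ → Subalgebra k H)
    (z : Ξ → H) (d : Ξ → Γ) : Prop where
  step : ∀ ξ, IsOreStep 𝒜 Δ (E ξ) (z ξ) (d ξ)
  base_le : ∀ ξ, B ≤ E ξ
  total : ∀ ξ η, extend (E ξ) (z ξ) ≤ E η ∨ extend (E η) (z η) ≤ E ξ ∨ ξ = η

variable {𝒜} {Δ : H →ₐ[k] H ⊗[k] H} {ε : Module.Dual k H} {B : Subalgebra k H}
variable {E : Ξ → Subalgebra k H} {z : Ξ → H} {d : Ξ → Γ} {act : H →ₗ[k] H →ₗ[k] H}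

/-- All other generators of a finite set then lie in the base `E ξ` of the top step, so its freeness
governs the whole set. -/
theorem IsOreChain.exists_top (h : IsOreChain 𝒜 Δ B E z d) {s : Finset Ξ} (hs : s.Nonempty) :
    ∃ ξ ∈ s, ∀ η ∈ s, η ≠ ξ → extend (E η) (z η) ≤ E ξ := by
  obtain ⟨ξ, hξ⟩ := Finset.exists_maximalFor E s hs
  refine ⟨ξ, hξ.1, fun η hη hne => ?_⟩
  rcases h.total η ξ with hle | hle | rfl
  · exact hle
  · exact absurd (hξ.2 hη (le_extend.trans hle) (hle self_mem_extend)) (h.step ξ).notMem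
  · exact absurd rfl hne

/-- The span of the elements `b • m` for `b ∈ B` and `m` an ordered monomial in those `z ξ` for
which the step at `ξ` takes place inside `F`. -/
def monomialSpan (act : H →ₗ[k] H →ₗ[k] H) (B : Subalgebra k H) (E : Ξ → Subalgebra k H)
    (z : Ξ → H) (ord : LinearOrder Ξ) (F : Subalgebra k H) : Submodule k H :=
  Submodule.span k {y | ∃ b ∈ B, ∃ r : Ξ →₀ ℕ, (∀ ξ ∈ r.support, extend (E ξ) (z ξ) ≤ F) ∧
    act b (monomial ord z r) = y}

theorem monomialSpan_mono (ord : LinearOrder Ξ) {F G : Subalgebra k H} (h : F ≤ G) :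
    monomialSpan act B E z ord F ≤ monomialSpan act B E z ord G :=
  Submodule.span_mono fun _ ⟨b, hb, r, hr, e⟩ => ⟨b, hb, r, fun ξ hξ => (hr ξ hξ).trans h, e⟩

theorem base_le_monomialSpan (hact : IsMulAction act) (ord : LinearOrder Ξ) (F : Subalgebra k H) :
    Subalgebra.toSubmodule B ≤ monomialSpan act B E z ord F := fun b hb =>
  Submodule.subset_span ⟨b, hb, 0, by simp, by rw [monomial_zero, hact.apply_one]⟩

theorem IsOreChain.exists_monomial_mem_deg (h : IsOreChain 𝒜 Δ B E z d) (ord : LinearOrder Ξ)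
    (r : Ξ →₀ ℕ) : ∃ γ, monomial ord z r ∈ 𝒜 γ :=
  ⟨_, SetLike.list_prod_map_mem_graded _ (fun ξ => r ξ • d ξ) _
    fun ξ _ => SetLike.pow_mem_graded _ (h.step ξ).mem_deg⟩

theorem IsOreChain.isHom_monomialSpan (h : IsOreChain 𝒜 Δ B E z d) (hact : IsMulAction act)
    (hB : IsHom 𝒜 (Subalgebra.toSubmodule B)) (ord : LinearOrder Ξ) (F : Subalgebra k H) :
    IsHom 𝒜 (monomialSpan act B E z ord F) := by
  intro a ha γ
  have : monomialSpan act B E z ord F ≤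
      (monomialSpan act B E z ord F).comap (GradedAlgebra.proj 𝒜 γ) := by
    refine Submodule.span_le.2 ?_
    rintro _ ⟨b, hb, r, hr, rfl⟩
    obtain ⟨μ, hμ⟩ := h.exists_monomial_mem_deg ord r
    refine hB.le_of_homogeneous (Q := (monomialSpan act B E z ord F).comap
      (GradedAlgebra.proj 𝒜 γ ∘ₗ act.flip (monomial ord z r))) (fun β b hb hβ => ?_) hb
    refine proj_mem_of_mem 𝒜 (γ := β + μ) (P := monomialSpan act B E z ord F) ?_
      fun _ => Submodule.subset_span ⟨b, hb, r, hr, rfl⟩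
    rcases hact with rfl | rfl
    · exact SetLike.GradedMul.mul_mem hβ hμ
    · rw [add_comm]
      exact SetLike.GradedMul.mul_mem hμ hβ
  exact this ha

/-- Inserting z ξ ^ n at its place in a monomial agrees, modulo lower powers of z ξ, with
multiplying by it on the right. -/
theorem IsOreChain.mul_pow_mem (h : IsOreChain 𝒜 Δ B E z d) (hact : IsMulAction act)
    (ord : LinearOrder Ξ) (ξ : Ξ) (n : ℕ) {e : H} (he : e ∈ monomialSpan act B E z ord (E ξ)) :
    e * z ξ ^ n ∈ monomialSpan act B E z ord (extend (E ξ) (z ξ)) ⊔ powFilt (E ξ) (z ξ) n := by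
  have : monomialSpan act B E z ord (E ξ) ≤ (monomialSpan act B E z ord (extend (E ξ) (z ξ)) ⊔
      powFilt (E ξ) (z ξ) n).comap (LinearMap.mulRight k (z ξ ^ n)) := by
    refine Submodule.span_le.2 ?_
    rintro _ ⟨b, hb, r, hr, rfl⟩
    have hξ : ξ ∉ r.support := fun hξ => (h.step ξ).notMem (hr ξ hξ self_mem_extend)
    have hrξ : r ξ = 0 := Finsupp.notMem_support_iff.1 hξ
    let r' := r + Finsupp.single ξ n
    have hr' : ∀ η ∈ r'.support, η ≠ ξ → η ∈ r.support := by
      intro η hη hne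
      simpa [r', Finsupp.single_eq_of_ne hne] using hη
    obtain ⟨a, ha, c, hc, e1, e2⟩ := exists_monomial_split ord (z := z) r' ξ (P := E ξ)
      fun η hη hne => hr η (hr' η hη hne) self_mem_extend
    have h3 : r'.erase ξ = r := by
      simp [r', Finsupp.erase_add, Finsupp.erase_of_notMem_support hξ]
    have h4 : r' ξ = n := by simp [r', hrξ]
    rw [h3] at e2
    rw [h4] at e1
    have h5 := hact.split (h.step ξ).ad_mem (h.base_le ξ hb) ha hc n
    rw [← e1, ← e2] at h5
    have h6 : act b (monomial ord z r') ∈ monomialSpan act B E z ord (extend (E ξ) (z ξ)) := by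
      refine Submodule.subset_span ⟨b, hb, r', fun η hη => ?_, rfl⟩
      by_cases hne : η = ξ
      · rw [hne]
      · exact (hr η (hr' η hη hne)).trans le_extend
    rw [SetLike.mem_coe, Submodule.mem_comap, LinearMap.mulRight_apply]
    have := sub_mem (Submodule.mem_sup_left (T := powFilt (E ξ) (z ξ) n) h6)
      (Submodule.mem_sup_right (S := monomialSpan act B E z ord (extend (E ξ) (z ξ))) h5)
    rwa [sub_sub_cancel] at this
  exact this he

variable [IsOrderedCancelAddMonoid Γ] [WellFoundedLT Γ]

/-- Induction on the power of z ξ. Degrees are nonnegative, so in degree γ only coefficients of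
degree at most γ occur, and spanning of `E ξ` up to γ suffices. -/
theorem IsOreChain.extend_spanned (h : IsOreChain 𝒜 Δ B E z d) (hact : IsMulAction act)
    (hB : IsHom 𝒜 (Subalgebra.toSubmodule B)) (ord : LinearOrder Ξ)
    (ξ : Ξ) {γ : Γ}
    (ih : ∀ β ≤ γ, ∀ a ∈ E ξ, a ∈ 𝒜 β → a ∈ monomialSpan act B E z ord (E ξ)) {a : H}
    (ha : a ∈ extend (E ξ) (z ξ)) (hγ : a ∈ 𝒜 γ) :
    a ∈ monomialSpan act B E z ord (extend (E ξ) (z ξ)) := by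
  have hs := h.step ξ
  obtain ⟨n, hn⟩ := exists_mem_powFilt hs.ad_mem ha
  clear ha
  induction n generalizing a with
  | zero =>
    have : a = 0 := by simpa [powFilt] using hn
    rw [this]
    exact zero_mem _
  | succ n ihn =>
    -- The remainder f need not be homogeneous; its component of degree γ is, and stays in the
    -- filtration step.
    have ihn' : ∀ f ∈ powFilt (E ξ) (z ξ) n,
        GradedAlgebra.proj 𝒜 γ f ∈ monomialSpan act B E z ord (extend (E ξ) (z ξ)) := fun f hf =>
      ihn (proj_mem 𝒜 γ f) (isHom_powFilt hs.isHom hs.mem_deg n f hf γ)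
    obtain ⟨f, hf, e, he, rfl⟩ := mem_powFilt_succ.1 hn
    have h1 : Subalgebra.toSubmodule (E ξ) ≤ (monomialSpan act B E z ord
        (extend (E ξ) (z ξ))).comap (GradedAlgebra.proj 𝒜 γ ∘ₗ LinearMap.mulRight k (z ξ ^ n)) := by
      refine hs.isHom.le_of_homogeneous fun β e he hβ => ?_
      have hdeg := SetLike.GradedMul.mul_mem hβ (SetLike.pow_mem_graded n hs.mem_deg)
      by_cases hβγ : β ≤ γ
      · obtain ⟨y, hy, f, hf, e1⟩ := Submodule.mem_sup.1
          (h.mul_pow_mem hact ord ξ n (ih β hβγ e he hβ))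
        rw [Submodule.mem_comap, LinearMap.comp_apply, LinearMap.mulRight_apply, ← e1, map_add]
        exact add_mem (h.isHom_monomialSpan hact hB ord _ y hy γ) (ihn' f hf)
      · refine proj_mem_of_mem 𝒜 (P := monomialSpan act B E z ord (extend (E ξ) (z ξ))) hdeg
          fun e => absurd ?_ hβγ
        rw [← e]
        exact le_add_of_nonneg_right (zero_le_of_wellFounded _)
    rw [← proj_of_mem_same 𝒜 hγ, map_add]
    exact add_mem (ihn' f hf) (h1 he)

/-- The coefficients of a relation between ordered monomials vanish. -/
theorem IsOreChain.coeff_eq_zero [CharZero k] (h : IsOreChain 𝒜 Δ B E z d)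
    (hΔ : IsConnectedComul 𝒜 Δ ε) (hact : IsMulAction act) (ord : LinearOrder Ξ) (s : Finset Ξ) :
    ∀ (R : Finset (Ξ →₀ ℕ)) (c : (Ξ →₀ ℕ) → H), (∀ r ∈ R, c r ∈ B) → (∀ r ∈ R, r.support ⊆ s) →
      ∑ r ∈ R, act (c r) (monomial ord z r) = 0 → ∀ r ∈ R, c r = 0 := by
  classical
  induction s using Finset.strongInduction with
  | H s ih =>
    rcases s.eq_empty_or_nonempty with rfl | hne
    · intro R c _ hs hsum r hr
      have h0 : ∀ r ∈ R, r = 0 := fun r hr => by simpa using hs r hr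
      have hR : R = {0} := by
        ext q
        refine ⟨fun hq => by simpa using h0 q hq, fun hq => ?_⟩
        rw [Finset.mem_singleton.1 hq, ← h0 r hr]
        exact hr
      rw [h0 r hr]
      simpa [hR, hact.apply_one] using hsum
    obtain ⟨ξ, hξ, htop⟩ := h.exists_top hne
    have ih := ih (s.erase ξ) (Finset.erase_ssubset hξ)
    have hs := h.step ξ
    -- The inner induction is on a strict bound N for the exponent of the top generator ξ.
    suffices H : ∀ (N : ℕ) (R : Finset (Ξ →₀ ℕ)) (c : (Ξ →₀ ℕ) → H), (∀ r ∈ R, c r ∈ B) →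
        (∀ r ∈ R, r.support ⊆ s) → (∀ r ∈ R, r ξ < N) →
        ∑ r ∈ R, act (c r) (monomial ord z r) = 0 → ∀ r ∈ R, c r = 0 by
      intro R c hc hR hsum
      refine H (R.sup (fun r => r ξ) + 1) R c hc hR (fun r hr => ?_) hsum
      exact Nat.lt_succ_of_le (Finset.le_sup (f := fun r : Ξ →₀ ℕ => r ξ) hr)
    intro N
    induction N with
    | zero => exact fun R c _ _ hN _ r hr => absurd (hN r hr) (Nat.not_lt_zero _)
    | succ N ihN =>
      intro R c hc hR hN hsum
      have hmem : ∀ r ∈ R, ∀ η ∈ r.support, η ≠ ξ → η ∈ s.erase ξ := fun r hr η hη hne =>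
        Finset.mem_erase.2 ⟨hne, hR r hr hη⟩
      have hz : ∀ η ∈ s.erase ξ, z η ∈ E ξ := fun η hη =>
        htop η (Finset.mem_of_mem_erase hη) (Finset.ne_of_mem_erase hη) self_mem_extend
      have herase : ∀ r ∈ R, (r.erase ξ).support ⊆ s.erase ξ := fun r hr η hη => by
        rw [Finsupp.support_erase, Finset.mem_erase] at hη
        exact hmem r hr η hη.2 hη.1
      have hsplit : ∀ r ∈ R, act (c r) (monomial ord z r) -
          act (c r) (monomial ord z (r.erase ξ)) * z ξ ^ r ξ ∈ powFilt (E ξ) (z ξ) (r ξ) := by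
        intro r hr
        obtain ⟨a, ha, b, hb, e1, e2⟩ := exists_monomial_split ord (z := z) r ξ (P := E ξ)
          fun η hη hne => hz η (hmem r hr η hη hne)
        rw [e1, e2]
        exact hact.split hs.ad_mem (h.base_le ξ (hc r hr)) ha hb _
      have hE : ∀ r ∈ R, act (c r) (monomial ord z (r.erase ξ)) ∈ E ξ := fun r hr =>
        hact.mem (h.base_le ξ (hc r hr)) (monomial_mem ord fun η hη => hz η (herase r hr hη))
      have hlow : ∑ r ∈ R with r ξ ≠ N, act (c r) (monomial ord z r) ∈
          powFilt (E ξ) (z ξ) N := by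
        refine Submodule.sum_mem _ fun r hr => ?_
        obtain ⟨hr, hne⟩ := Finset.mem_filter.1 hr
        have := add_mem (powFilt_le_succ _ (hsplit r hr)) (mul_pow_mem_powFilt (hE r hr) (r ξ))
        rw [sub_add_cancel] at this
        exact powFilt_mono (by have := hN r hr; omega) this
      have hhigh : ∑ r ∈ R with r ξ = N, (act (c r) (monomial ord z r) -
          act (c r) (monomial ord z (r.erase ξ)) * z ξ ^ N) ∈ powFilt (E ξ) (z ξ) N := by
        refine Submodule.sum_mem _ fun r hr => ?_
        obtain ⟨hrR, rfl⟩ := Finset.mem_filter.1 hr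
        exact hsplit r hrR
      rw [← Finset.sum_filter_add_sum_filter_not R (fun r => r ξ = N)] at hsum
      -- The coefficient of z ξ ^ N vanishes by freeness of the top step. It is itself a relation
      -- between monomials without ξ, to which the outer induction applies.
      have hlead : ∑ r ∈ R with r ξ = N, act (c r) (monomial ord z (r.erase ξ)) = 0 := by
        refine hs.eq_zero_of_mul_pow_mem hΔ N _ (sum_mem fun r hr =>
          hE r (Finset.mem_filter.1 hr).1) ?_
        have h2 := neg_mem (add_mem hlow hhigh)
        rw [Finset.sum_sub_distrib, ← Finset.sum_mul] at h2
        have h3 : ∀ a b e : H, a + b = 0 → -(b + (a - e)) = e := fun a b e h => by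
          rw [add_sub_assoc', add_comm b a, h, zero_sub, neg_neg]
        rwa [h3 _ _ _ hsum] at h2
      have hzero : ∀ r ∈ R, r ξ = N → c r = 0 := by
        have hinj : Set.InjOn (fun r : Ξ →₀ ℕ => r.erase ξ) {r ∈ R | r ξ = N} := by
          intro r hr r' hr' e
          rw [← Finsupp.single_add_erase ξ r, ← Finsupp.single_add_erase ξ r', hr.2, hr'.2]
          exact congrArg _ e
        have hback : ∀ r ∈ R, r ξ = N → r.erase ξ + Finsupp.single ξ N = r := by
          rintro r _ rfl
          exact Finsupp.erase_add_single ξ r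
        have key := ih ({r ∈ R | r ξ = N}.image fun r => r.erase ξ)
          (fun r => c (r + Finsupp.single ξ N)) ?_ ?_ ?_
        · intro r hr hrN
          have := key (r.erase ξ) (Finset.mem_image_of_mem _ (Finset.mem_filter.2 ⟨hr, hrN⟩))
          rwa [hback r hr hrN] at this
        · intro q hq
          obtain ⟨r, hr, rfl⟩ := Finset.mem_image.1 hq
          obtain ⟨hr, hrN⟩ := Finset.mem_filter.1 hr
          rw [hback r hr hrN]
          exact hc r hr
        · intro q hq
          obtain ⟨r, hr, rfl⟩ := Finset.mem_image.1 hq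
          exact herase r (Finset.mem_filter.1 hr).1
        · rw [Finset.sum_image (by simpa using hinj), ← hlead]
          refine Finset.sum_congr rfl fun r hr => ?_
          obtain ⟨hr, hrN⟩ := Finset.mem_filter.1 hr
          rw [hback r hr hrN]
      have hrest : ∑ r ∈ R with ¬ r ξ = N, act (c r) (monomial ord z r) = 0 := by
        rw [Finset.sum_eq_zero (s := {r ∈ R | r ξ = N}), zero_add] at hsum
        · exact hsum
        · intro r hr
          obtain ⟨hr, hrN⟩ := Finset.mem_filter.1 hr
          rw [hzero r hr hrN, map_zero, LinearMap.zero_apply]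
      intro r hr
      by_cases hrN : r ξ = N
      · exact hzero r hr hrN
      · refine ihN _ c (fun r hr => hc r (Finset.mem_filter.1 hr).1)
          (fun r hr => hR r (Finset.mem_filter.1 hr).1) (fun r hr => ?_) hrest r
          (Finset.mem_filter.2 ⟨hr, hrN⟩)
        obtain ⟨hr, hne⟩ := Finset.mem_filter.1 hr
        have := hN r hr
        omega

/-- Every homogeneous element of `A`, and of the lower ends of the steps, is a combination of
ordered monomials as soon as the steps include all jumps between `B` and `A`. -/
theorem IsOreChain.pair_spanned (h : IsOreChain 𝒜 Δ B E z d) (hΔ : IsConnectedComul 𝒜 Δ ε)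
    (hact : IsMulAction act) (hB : IsHom 𝒜 (Subalgebra.toSubmodule B)) (ord : LinearOrder Ξ)
    {A : Subalgebra k H} (hJ : ∀ F q, Jump 𝒜 B A F q → ∃ ξ, E ξ = F ∧ z ξ = q.2) (γ : Γ)
    (ih : ∀ β < γ, ∀ F q, Jump 𝒜 B A F q → ∀ a ∈ F, a ∈ 𝒜 β → a ∈ monomialSpan act B E z ord F)
    (ε' : Γ) : ∀ (δ : Γ) (C D : Subalgebra k H), IsCoidealPair 𝒜 Δ δ C D →
      (∀ F q, Jump 𝒜 C D F q → Jump 𝒜 B A F q) → δ + ε' = γ →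
      (∀ a ∈ C, a ∈ 𝒜 γ → a ∈ monomialSpan act B E z ord C) →
      (∀ a ∈ D, a ∈ 𝒜 γ → a ∈ monomialSpan act B E z ord D) ∧
      ∀ F q, Jump 𝒜 C D F q → ∀ a ∈ F, a ∈ 𝒜 γ → a ∈ monomialSpan act B E z ord F := by
  induction ε' using WellFoundedLT.induction with
  | ind ε' ihε =>
    intro δ C D hCD hsub hγ hC
    -- Descent into the pair formed by `lowerPart` and its closure: either the remainder of γ drops,
    -- or the two agree in degree γ.
    have key : ∀ p, IsCandidate 𝒜 D p → p.2 ∉ lowerPart 𝒜 C D p →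
        (∀ a ∈ lowerPart 𝒜 C D p, a ∈ 𝒜 γ →
          a ∈ monomialSpan act B E z ord (lowerPart 𝒜 C D p)) →
        (∀ a ∈ adClosure (lowerPart 𝒜 C D p) p.2, a ∈ 𝒜 γ →
          a ∈ monomialSpan act B E z ord (adClosure (lowerPart 𝒜 C D p) p.2)) ∧
        ∀ F q, Jump 𝒜 (lowerPart 𝒜 C D p) (adClosure (lowerPart 𝒜 C D p) p.2) F q →
          ∀ a ∈ F, a ∈ 𝒜 γ → a ∈ monomialSpan act B E z ord F := by
      intro p hp hnot hL
      have hpair := hCD.adClosure hΔ hp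
      by_cases hε : ∃ ε'', ε'' ≠ 0 ∧ γ = p.1 + ε''
      · obtain ⟨ε'', -, e⟩ := hε
        obtain ⟨α, hα, e2⟩ := hCD.degree p.1 p.2 hp.1 hp.2 fun hmem => hnot (le_lowerPart hmem)
        refine ihε ε'' ?_ p.1 _ _ hpair (fun F q hF => hsub F q (Jump.deeper hp hnot hF)) e.symm hL
        -- Since p.2 ∉ C, the degree p.1 exceeds δ by a nonzero α, so the new remainder ε'' is
        -- smaller than ε'.
        have : ε' = α + ε'' := by
          rw [e2, ← hγ, add_assoc] at e
          exact add_left_cancel e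
        rw [this]
        exact lt_add_of_pos_left _ (lt_of_le_of_ne (zero_le_of_wellFounded α) hα.symm)
      · have hmem : ∀ a ∈ adClosure (lowerPart 𝒜 C D p) p.2, a ∈ 𝒜 γ →
            a ∈ lowerPart 𝒜 C D p := fun a ha haγ => by
          by_contra hcon
          exact hε (hpair.degree γ a ha haγ hcon)
        refine ⟨fun a ha haγ => monomialSpan_mono ord le_adClosure (hL a (hmem a ha haγ) haγ),
          fun F q hF a ha haγ => ?_⟩
        obtain ⟨h1, h2⟩ := hF.bounds le_adClosure
        exact monomialSpan_mono ord h1 (hL a (hmem a (h2 (le_extend ha)) haγ) haγ)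
    have hext : ∀ p, IsCandidate 𝒜 D p →
        (∀ a ∈ lowerPart 𝒜 C D p, a ∈ 𝒜 γ →
          a ∈ monomialSpan act B E z ord (lowerPart 𝒜 C D p)) →
        ∀ a ∈ extend (lowerPart 𝒜 C D p) p.2, a ∈ 𝒜 γ →
          a ∈ monomialSpan act B E z ord (extend (lowerPart 𝒜 C D p) p.2) := by
      intro p hp hL a ha haγ
      by_cases hnot : p.2 ∈ lowerPart 𝒜 C D p
      · have hle : extend (lowerPart 𝒜 C D p) p.2 ≤ lowerPart 𝒜 C D p :=
          Algebra.adjoin_le (Set.union_subset subset_rfl (by simpa using hnot))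
        exact monomialSpan_mono ord le_extend (hL a (hle ha) haγ)
      · have hjump := hsub _ _ (Jump.here hp hnot)
        obtain ⟨ξ, e1, e2⟩ := hJ _ _ hjump
        have hup : extend (lowerPart 𝒜 C D p) p.2 ≤
            extend (adClosure (lowerPart 𝒜 C D p) p.2) p.2 :=
          Algebra.adjoin_mono (Set.union_subset_union_left _ le_adClosure)
        have hdown : extend (adClosure (lowerPart 𝒜 C D p) p.2) p.2 ≤
            extend (lowerPart 𝒜 C D p) p.2 := adjoin_adClosure_le
        have := h.extend_spanned hact hB ord ξ (γ := γ) (fun β hβ a ha haβ => ?_)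
          (a := a) (by rw [e1, e2]; exact hup ha) haγ
        · rw [e1, e2] at this
          exact monomialSpan_mono ord hdown this
        · rw [e1] at ha ⊢
          -- Coefficients of degree below γ come from the induction on γ, those of degree γ from
          -- `key`.
          rcases hβ.lt_or_eq with hβ | rfl
          · exact ih β hβ _ _ hjump a ha haβ
          · exact (key p hp hnot hL).1 a ha haβ
    have hlow : ∀ p, ∀ a ∈ lowerPart 𝒜 C D p, a ∈ 𝒜 γ →
        a ∈ monomialSpan act B E z ord (lowerPart 𝒜 C D p) := by
      intro p
      induction p using (IsWellFounded.wf : WellFounded (degPrec (Γ := Γ) (H := H))).induction with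
      | _ p ihp =>
        intro a ha haγ
        rcases mem_lowerPart_cases ha with ha | ⟨q, hq, hqp, ha⟩
        · exact monomialSpan_mono ord le_lowerPart (hC a ha haγ)
        · exact monomialSpan_mono ord (adjoin_lowerPart_le_lowerPart hq hqp)
            (hext q hq (ihp q hqp) a ha haγ)
    refine ⟨fun a ha haγ => ?_, fun F q hF => ?_⟩
    -- A homogeneous a ∈ D is its own candidate, so it lies in the extension attached to (γ, a).
    · have hp : IsCandidate 𝒜 D (γ, a) := ⟨ha, haγ⟩
      exact monomialSpan_mono ord (adjoin_lowerPart_le hCD.le hp)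
        (hext (γ, a) hp (hlow _) a self_mem_extend haγ)
    · cases hF with
      | here hp hnot => exact (key _ hp hnot (hlow _)).1
      | deeper hp hnot hF => exact (key _ hp hnot (hlow _)).2 F q hF

theorem IsOreChain.spanned (h : IsOreChain 𝒜 Δ B E z d) (hΔ : IsConnectedComul 𝒜 Δ ε)
    (hact : IsMulAction act) (ord : LinearOrder Ξ) {A : Subalgebra k H}
    (hBA : IsCoidealPair 𝒜 Δ 0 B A)
    (hJ : ∀ F q, Jump 𝒜 B A F q → ∃ ξ, E ξ = F ∧ z ξ = q.2) (γ : Γ) :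
    (∀ a ∈ A, a ∈ 𝒜 γ → a ∈ monomialSpan act B E z ord A) ∧
      ∀ F q, Jump 𝒜 B A F q → ∀ a ∈ F, a ∈ 𝒜 γ → a ∈ monomialSpan act B E z ord F := by
  induction γ using WellFoundedLT.induction with
  | ind γ ih =>
    exact h.pair_spanned hΔ hact hBA.homC ord hJ γ (fun β hβ => (ih β hβ).2) γ 0 B A hBA
      (fun _ _ => id) (zero_add γ) fun a ha _ => base_le_monomialSpan hact ord B ha

end Chains

/-! ### Both sides of the comultiplication, and the antipode -/

section Comultiplication

variable {k : Type u} {H : Type v} [Field k] [Ring H] [HopfAlgebra k H]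
variable {Γ : Type w} [AddCommMonoid Γ] [LinearOrder Γ] [IsOrderedCancelAddMonoid Γ]
variable [WellFoundedLT Γ] {𝒜 : Γ → Submodule k H} [GradedAlgebra 𝒜]

variable (k H) in
/-- The comultiplication for `Side.left`, and its co-opposite for `Side.right`. -/
noncomputable def sideComul : Side → H →ₐ[k] H ⊗[k] H
  | Side.left => Bialgebra.comulAlgHom k H
  | Side.right => (Algebra.TensorProduct.comm k H H).toAlgHom.comp (Bialgebra.comulAlgHom k H)

theorem comm_mem_tensorSub {U V : Submodule k H} {t : H ⊗[k] H} :
    TensorProduct.comm k H H t ∈ tensorSub V U ↔ t ∈ tensorSub U V := by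
  have key : ∀ U V : Submodule k H, tensorSub U V ≤
      (tensorSub V U).comap (TensorProduct.comm k H H).toLinearMap := fun U V =>
    tensorSub_le fun a ha b hb => by simpa using tmul_mem_tensorSub hb ha
  refine ⟨fun h => ?_, fun h => key U V h⟩
  have := key V U h
  rw [Submodule.mem_comap] at this
  convert this
  exact (TensorProduct.comm_comm k H H t).symm

theorem isCoideal_iff {s : Side} {K : Submodule k H} :
    IsCoideal s K ↔ ∀ x ∈ K, sideComul k H s x ∈ tensorSub ⊤ K := by
  cases s with
  | left => exact Iff.rfl
  | right => exact forall₂_congr fun x _ => comm_mem_tensorSub.symm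

/-- By connectedness the summand with left degree 0 is 1 ⊗ w with w of degree γ. Contracting with f
and comparing components of degree γ gives w = y. -/
theorem comul_sub_mem_of_graded (hconn : ∀ y ∈ 𝒜 0, ∃ c : k, y = c • (1 : H)) {t : H ⊗[k] H} {y : H}
    {γ : Γ} {f : Module.Dual k H} (hf : f 1 = 1) (hy : y ∈ 𝒜 γ) (hty : slice f t = y)
    (ht : t ∈ ⨆ p : {p : Γ × Γ // p.1 + p.2 = γ}, tensorSub (𝒜 p.1.1) (𝒜 p.1.2)) :
    t - 1 ⊗ₜ[k] y ∈ tensorSub ⊤ (⨆ β : Set.Iio γ, 𝒜 β) := by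
  have hle : (⨆ p : {p : Γ × Γ // p.1 + p.2 = γ}, tensorSub (𝒜 p.1.1) (𝒜 p.1.2)) ≤
      (𝒜 γ).map (TensorProduct.mk k H H 1) ⊔ tensorSub ⊤ (⨆ β : Set.Iio γ, 𝒜 β) := by
    refine iSup_le ?_
    rintro ⟨⟨α, β⟩, h⟩
    simp only at h
    by_cases hα : α = 0
    · subst hα
      rw [zero_add] at h
      subst h
      refine le_trans (tensorSub_le fun a ha b hb => ?_) le_sup_left
      obtain ⟨c, rfl⟩ := hconn a ha
      exact ⟨c • b, (𝒜 β).smul_mem c hb, (TensorProduct.smul_tmul c 1 b).symm⟩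
    · have hlt : β < γ := by
        rw [← h]
        exact lt_add_of_pos_left _ (lt_of_le_of_ne (zero_le_of_wellFounded α) (Ne.symm hα))
      exact le_trans (tensorSub_mono le_top
        (le_iSup (fun β : Set.Iio γ => 𝒜 β) ⟨β, hlt⟩)) le_sup_right
  obtain ⟨_, ⟨w, hw, rfl⟩, r, hr, rfl⟩ := Submodule.mem_sup.1 (hle ht)
  have h1 := slice_mem_of_mem hr f
  have h2 : slice f r = y - w := by
    rw [← hty]
    simp [hf]
  have h3 : (⨆ β : Set.Iio γ, 𝒜 β) ≤ LinearMap.ker (GradedAlgebra.proj 𝒜 γ) :=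
    iSup_le fun β z hz => proj_of_mem_ne 𝒜 hz (ne_of_lt β.2)
  have h4 : y - w = 0 := by
    rw [← proj_of_mem_same 𝒜 (sub_mem hy hw), ← h2]
    exact h3 h1
  rw [← sub_eq_zero.1 h4] at *
  simpa using hr

theorem isConnectedComul_sideComul (hgr : IsCoalgebraGrading 𝒜)
    (hconn : ∀ y ∈ 𝒜 0, ∃ c : k, y = c • (1 : H)) (s : Side) :
    IsConnectedComul 𝒜 (sideComul k H s) (Coalgebra.counit (R := k) (A := H)) := by
  have hl : ∀ y : H, slice (Coalgebra.counit (R := k) (A := H)) (Coalgebra.comul (R := k) y) = y :=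
    fun y => by simp [slice]
  have hr : ∀ y : H,
      rightSlice (Coalgebra.counit (R := k) (A := H)) (Coalgebra.comul (R := k) y) = y :=
    fun y => by simp [rightSlice]
  have hcl : ∀ (f : Module.Dual k H) (t : H ⊗[k] H),
      slice f (TensorProduct.comm k H H t) = rightSlice f t := fun f t => by
    induction t using TensorProduct.induction_on with
    | zero => simp
    | tmul a b => simp
    | add a b ha hb => simp only [map_add, ha, hb]
  have hcr : ∀ (f : Module.Dual k H) (t : H ⊗[k] H),
      rightSlice f (TensorProduct.comm k H H t) = slice f t := fun f t => by
    induction t using TensorProduct.induction_on with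
    | zero => simp
    | tmul a b => simp
    | add a b ha hb => simp only [map_add, ha, hb]
  refine ⟨?_, ?_, Bialgebra.counit_one, hgr.counit_eq_zero, hconn⟩
  · intro γ y hy
    cases s with
    | left =>
      exact comul_sub_mem_of_graded (t := Coalgebra.comul (R := k) y) hconn Bialgebra.counit_one hy
        (hl y) (hgr.comul_mem γ y hy)
    | right =>
      refine comul_sub_mem_of_graded hconn Bialgebra.counit_one hy ((hcl _ _).trans (hr y)) ?_
      have : (⨆ p : {p : Γ × Γ // p.1 + p.2 = γ}, tensorSub (𝒜 p.1.1) (𝒜 p.1.2)) ≤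
          (⨆ p : {p : Γ × Γ // p.1 + p.2 = γ}, tensorSub (𝒜 p.1.1) (𝒜 p.1.2)).comap
            (TensorProduct.comm k H H).toLinearMap := by
        refine iSup_le ?_
        rintro ⟨⟨α, β⟩, h⟩ t ht
        exact Submodule.mem_iSup_of_mem ⟨(β, α), (add_comm β α).trans h⟩ (comm_mem_tensorSub.2 ht)
      exact this (hgr.comul_mem γ y hy)
  · intro y
    cases s with
    | left => exact hr y
    | right => exact (hcr _ _).trans (hl y)

theorem comul_mem_of_isCoideal {K : Submodule k H} (hl : IsCoideal Side.left K)
    (hr : IsCoideal Side.right K) {x : H} (hx : x ∈ K) :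
    Coalgebra.comul (R := k) x ∈ tensorSub K K :=
  mem_tensorSub_of_mem_of_mem (hl x hx) (hr x hx)

theorem IsHopfSubalgebra.isCoideal {K : Subalgebra k H} (h : IsHopfSubalgebra K) (s : Side) :
    IsCoideal s (Subalgebra.toSubmodule K) := by
  cases s with
  | left => exact fun x hx => tensorSub_mono le_top le_rfl (h.comul_mem x hx)
  | right => exact fun x hx => tensorSub_mono le_rfl le_top (h.comul_mem x hx)

/-- A homogeneous subbialgebra of a connected graded Hopf algebra is a Hopf subalgebra. -/
theorem isHopfSubalgebra_of_isCoideal (hgr : IsCoalgebraGrading 𝒜)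
    (hconn : ∀ y ∈ 𝒜 0, ∃ c : k, y = c • (1 : H)) {K : Subalgebra k H}
    (hK : IsHom 𝒜 (Subalgebra.toSubmodule K))
    (hs : ∀ s, IsCoideal s (Subalgebra.toSubmodule K)) : IsHopfSubalgebra K := by
  have hΔ := isConnectedComul_sideComul hgr hconn Side.left
  refine ⟨fun x hx => comul_mem_of_isCoideal (hs _) (hs _) hx, ?_⟩
  suffices h : ∀ γ, ∀ x ∈ K, x ∈ 𝒜 γ → HopfAlgebra.antipode k x ∈ K from fun x hx =>
    hK.le_of_homogeneous (Q := (Subalgebra.toSubmodule K).comap (HopfAlgebra.antipode k)) h hx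
  intro γ
  induction γ using WellFoundedLT.induction with
  | ind γ ih =>
    intro x hx hγ
    let P : Submodule k H := (Subalgebra.toSubmodule K).comap (HopfAlgebra.antipode k)
    -- The right factors have degree below γ, where the antipode is already known to preserve K.
    have h1 : Coalgebra.comul (R := k) x - 1 ⊗ₜ[k] x ∈ tensorSub ⊤ P := by
      rw [mem_tensorSub_top_iff]
      intro f
      have h2 := slice_mem_of_mem (hΔ.comul_sub_mem γ x hγ) f
      have h3 : slice f (Coalgebra.comul (R := k) x - 1 ⊗ₜ[k] x) ∈ Subalgebra.toSubmodule K := by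
        rw [map_sub, slice_tmul]
        exact sub_mem (slice_mem_of_mem (hs Side.left x hx) f) (K.smul_mem hx _)
      refine mem_of_proj_mem 𝒜 fun β => ?_
      by_cases hβ : β < γ
      · exact ih β hβ _ (hK _ h3 β) (proj_mem 𝒜 β _)
      · have : (⨆ α : Set.Iio γ, 𝒜 α) ≤ LinearMap.ker (GradedAlgebra.proj 𝒜 β) :=
          iSup_le fun α z hz => proj_of_mem_ne 𝒜 hz fun e => hβ (e ▸ α.2)
        have h4 : GradedAlgebra.proj 𝒜 β (slice f (Coalgebra.comul (R := k) x - 1 ⊗ₜ[k] x)) = 0 :=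
          this h2
        rw [h4]
        exact zero_mem _
    have h2 : Coalgebra.comul (R := k) x - 1 ⊗ₜ[k] x ∈ tensorSub (Subalgebra.toSubmodule K) ⊤ :=
      sub_mem (hs Side.right x hx) (tmul_mem_tensorSub (one_mem K) trivial)
    have h3 : tensorSub (Subalgebra.toSubmodule K) P ≤ (Subalgebra.toSubmodule K).comap
        (LinearMap.mul' k H ∘ₗ LinearMap.lTensor H (HopfAlgebra.antipode k)) :=
      tensorSub_le fun a ha b hb => by
        simpa using K.mul_mem ha hb
    -- Multiplying after id ⊗ S turns Δ(x) - 1 ⊗ x into ε(x) - S(x).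
    have h4 := h3 (mem_tensorSub_of_mem_of_mem h1 h2)
    rw [Submodule.mem_comap, LinearMap.comp_apply, map_sub, map_sub,
      HopfAlgebra.mul_antipode_lTensor_comul_apply, LinearMap.lTensor_tmul, LinearMap.mul'_apply,
      one_mul] at h4
    have h5 := sub_mem (K.algebraMap_mem (Coalgebra.counit (R := k) x)) h4
    rwa [sub_sub_cancel] at h5

end Comultiplication

/-! ### Bases over B on the left and on the right -/

section Bases

variable {k : Type u} {H : Type v} [Field k] [Ring H] [Algebra k H] {Ξ : Type*}
variable {Γ : Type w} [AddCommMonoid Γ] [LinearOrder Γ] [IsOrderedCancelAddMonoid Γ]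
variable [WellFoundedLT Γ] {𝒜 : Γ → Submodule k H} [GradedAlgebra 𝒜]
variable {Δ : H →ₐ[k] H ⊗[k] H} {ε : Module.Dual k H} {B F : Subalgebra k H}
variable {E : Ξ → Subalgebra k H} {z : Ξ → H} {d : Ξ → Γ} {ι : Type*} {e : ι → Ξ →₀ ℕ}

theorem IsOreChain.coeff_eq_zero_of_injective [CharZero k] (h : IsOreChain 𝒜 Δ B E z d)
    (hΔ : IsConnectedComul 𝒜 Δ ε) {act : H →ₗ[k] H →ₗ[k] H} (hact : IsMulAction act)
    (ord : LinearOrder Ξ) (he : Function.Injective e) (s : Finset ι) (g : ι → H)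
    (hg : ∀ i, g i ∈ B) (hsum : ∑ i ∈ s, act (g i) (monomial ord z (e i)) = 0) :
    ∀ i ∈ s, g i = 0 := by
  classical
  have hex : ∀ i, Function.extend e g 0 (e i) = g i := fun i => he.extend_apply g 0 i
  intro i hi
  rw [← hex i]
  refine h.coeff_eq_zero hΔ hact ord ((s.image e).biUnion Finsupp.support) (s.image e)
    (Function.extend e g 0) ?_ ?_ ?_ (e i) (Finset.mem_image_of_mem e hi)
  · intro r hr
    obtain ⟨j, -, rfl⟩ := Finset.mem_image.1 hr
    rw [hex]
    exact hg j
  · exact fun r hr => Finset.subset_biUnion_of_mem Finsupp.support hr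
  · rw [Finset.sum_image he.injOn, ← hsum]
    exact Finset.sum_congr rfl fun j _ => by rw [hex]

/-- The indexing map e lets the same argument serve all exponents, for A, and the bounded supports,
for the truncations. -/
theorem IsOreChain.isLeftBasis [CharZero k] (h : IsOreChain 𝒜 Δ B E z d)
    (hΔ : IsConnectedComul 𝒜 Δ ε) (ord : LinearOrder Ξ) (hBF : B ≤ F)
    (hF : Subalgebra.toSubmodule F ≤ monomialSpan (LinearMap.mul k H) B E z ord F)
    (he : Function.Injective e)
    (hrange : ∀ r : Ξ →₀ ℕ, r ∈ Set.range e ↔ ∀ ξ ∈ r.support, extend (E ξ) (z ξ) ≤ F) :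
    IsLeftBasis B F (fun i => monomial ord z (e i)) := by
  constructor
  · rw [linearIndependent_iff']
    intro s g hsum i hi
    exact Subtype.ext (h.coeff_eq_zero_of_injective hΔ (Or.inl rfl) ord he s
      (fun i => (g i : H)) (fun i => (g i).2) hsum i hi)
  · refine Set.Subset.antisymm (fun a ha => ?_) fun a ha => ?_
    · induction ha using Submodule.span_induction with
      | mem a ha =>
        obtain ⟨i, rfl⟩ := ha
        exact monomial_mem ord fun ξ hξ => (hrange _).1 ⟨i, rfl⟩ ξ hξ self_mem_extend
      | zero => exact F.zero_mem
      | add a b _ _ ha hb => exact F.add_mem ha hb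
      | smul b a _ ha => exact F.mul_mem (hBF b.2) ha
    · have hle : monomialSpan (LinearMap.mul k H) B E z ord F ≤
          (Submodule.span B (Set.range fun i => monomial ord z (e i))).restrictScalars k := by
        refine Submodule.span_le.2 ?_
        rintro _ ⟨b, hb, r, hr, rfl⟩
        obtain ⟨i, rfl⟩ := (hrange r).2 hr
        exact Submodule.smul_mem _ (⟨b, hb⟩ : B) (Submodule.subset_span ⟨i, rfl⟩)
      exact hle (hF ha)

theorem IsOreChain.isRightBasis [CharZero k] (h : IsOreChain 𝒜 Δ B E z d)
    (hΔ : IsConnectedComul 𝒜 Δ ε) (ord : LinearOrder Ξ) (hBF : B ≤ F)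
    (hF : Subalgebra.toSubmodule F ≤ monomialSpan (LinearMap.mul k H).flip B E z ord F)
    (he : Function.Injective e)
    (hrange : ∀ r : Ξ →₀ ℕ, r ∈ Set.range e ↔ ∀ ξ ∈ r.support, extend (E ξ) (z ξ) ≤ F) :
    IsRightBasis B F (fun i => monomial ord z (e i)) := by
  constructor
  · rw [linearIndependent_iff']
    intro s g hsum i hi
    exact Subtype.ext (congrArg MulOpposite.op (h.coeff_eq_zero_of_injective hΔ (Or.inr rfl) ord he s
      (fun i => (g i : Hᵐᵒᵖ).unop) (fun i => (g i).2) hsum i hi))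
  · refine Set.Subset.antisymm (fun a ha => ?_) fun a ha => ?_
    · induction ha using Submodule.span_induction with
      | mem a ha =>
        obtain ⟨i, rfl⟩ := ha
        exact monomial_mem ord fun ξ hξ => (hrange _).1 ⟨i, rfl⟩ ξ hξ self_mem_extend
      | zero => exact F.zero_mem
      | add a b _ _ ha hb => exact F.add_mem ha hb
      | smul b a _ ha => exact F.mul_mem ha (hBF b.2)
    · have hle : monomialSpan (LinearMap.mul k H).flip B E z ord F ≤
          (Submodule.span B.op (Set.range fun i => monomial ord z (e i))).restrictScalars k := by
        refine Submodule.span_le.2 ?_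
        rintro _ ⟨b, hb, r, hr, rfl⟩
        obtain ⟨i, rfl⟩ := (hrange r).2 hr
        exact Submodule.smul_mem _ (⟨MulOpposite.op b, hb⟩ : B.op) (Submodule.subset_span ⟨i, rfl⟩)
      exact hle (hF ha)

end Bases

/-! ### The order of the steps and the truncations -/

section Order

variable {k : Type u} {H : Type v} [Field k] [Ring H] [Algebra k H] {Ξ : Type*}
variable {Γ : Type w} [AddCommMonoid Γ] [LinearOrder Γ]
variable {𝒜 : Γ → Submodule k H} [GradedAlgebra 𝒜]
variable {Δ : H →ₐ[k] H ⊗[k] H} {ε : Module.Dual k H} {B : Subalgebra k H}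
variable {E : Ξ → Subalgebra k H} {z : Ξ → H} {d : Ξ → Γ}

theorem IsOreChain.not_extend_le (h : IsOreChain 𝒜 Δ B E z d) {ξ : Ξ} {F : Subalgebra k H}
    (hF : F ≤ E ξ) : ¬ extend (E ξ) (z ξ) ≤ F := fun hle =>
  (h.step ξ).notMem (hF (hle self_mem_extend))

open Classical in
/-- The order of the steps of an Ore chain. -/
@[reducible] noncomputable def IsOreChain.linearOrder (h : IsOreChain 𝒜 Δ B E z d) :
    LinearOrder Ξ where
  le ξ η := extend (E ξ) (z ξ) ≤ extend (E η) (z η)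
  le_refl ξ := le_refl (extend (E ξ) (z ξ))
  le_trans ξ η ζ h1 h2 := le_trans (a := extend (E ξ) (z ξ)) h1 h2
  le_antisymm ξ η h1 h2 := by
    rcases h.total ξ η with h3 | h3 | h3
    · exact absurd h2 fun h2 => h.not_extend_le h3 h2
    · exact absurd h1 fun h1 => h.not_extend_le h3 h1
    · exact h3
  le_total ξ η := by
    rcases h.total ξ η with h3 | h3 | h3
    · exact Or.inl (h3.trans le_extend)
    · exact Or.inr (h3.trans le_extend)
    · rw [h3]
      exact Or.inl (le_refl (extend (E η) (z η)))
  toDecidableLE := Classical.decRel _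

theorem IsOreChain.extend_le_of_lt (h : IsOreChain 𝒜 Δ B E z d) {ξ η : Ξ}
    (hlt : h.linearOrder.lt ξ η) : extend (E ξ) (z ξ) ≤ E η := by
  let := h.linearOrder
  rcases h.total ξ η with h3 | h3 | h3
  · exact h3
  · exact absurd hlt (not_lt_of_ge (show η ≤ ξ from h3.trans le_extend))
  · exact absurd h3 (ne_of_lt hlt)

theorem IsOreChain.lt_of_extend_le (h : IsOreChain 𝒜 Δ B E z d) {ξ η : Ξ}
    (hle : extend (E ξ) (z ξ) ≤ E η) : h.linearOrder.lt ξ η := by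
  let := h.linearOrder
  exact lt_of_not_ge (fun h2 : η ≤ ξ => h.not_extend_le hle h2)

theorem IsOreChain.truncation_eq (h : IsOreChain 𝒜 Δ B E z d) (ξ : Ξ)
    (hspan : Subalgebra.toSubmodule (extend (E ξ) (z ξ)) ≤
      monomialSpan (LinearMap.mul k H) B E z h.linearOrder (extend (E ξ) (z ξ))) :
    truncation B z h.linearOrder ξ = extend (E ξ) (z ξ) := by
  refine le_antisymm (Algebra.adjoin_le (Set.union_subset ?_ ?_)) fun a ha => ?_
  · exact (h.base_le ξ).trans le_extend
  · rintro _ ⟨η, hη, rfl⟩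
    exact hη self_mem_extend
  · have : monomialSpan (LinearMap.mul k H) B E z h.linearOrder (extend (E ξ) (z ξ)) ≤
        Subalgebra.toSubmodule (truncation B z h.linearOrder ξ) := by
      refine Submodule.span_le.2 ?_
      rintro _ ⟨b, hb, r, hr, rfl⟩
      refine Subalgebra.mul_mem _ (Algebra.subset_adjoin (Or.inl hb)) (monomial_mem _ ?_)
      exact fun η hη => Algebra.subset_adjoin (Or.inr ⟨η, hr η hη, rfl⟩)
    exact this (hspan ha)

/-- By spanning, `E ξ` is the directed union of the extensions below it; the given η makes this
family nonempty, so that it also contains B. -/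
theorem IsOreChain.exists_mem_extend (h : IsOreChain 𝒜 Δ B E z d) {ord : LinearOrder Ξ} {ξ η : Ξ}
    (hη : extend (E η) (z η) ≤ E ξ) {a : H}
    (ha : a ∈ monomialSpan (LinearMap.mul k H) B E z ord (E ξ)) :
    ∃ δ, extend (E δ) (z δ) ≤ E ξ ∧ a ∈ extend (E δ) (z δ) := by
  let T : {δ : Ξ // extend (E δ) (z δ) ≤ E ξ} → Subalgebra k H := fun δ => extend (E δ) (z δ)
  have hdir : Directed (· ≤ ·) T := fun δ δ' => by
    rcases h.total δ δ' with h3 | h3 | h3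
    · exact ⟨δ', h3.trans le_extend, le_rfl⟩
    · exact ⟨δ, le_rfl, h3.trans le_extend⟩
    · exact ⟨δ, le_rfl, by simp only [T, h3]; exact le_rfl⟩
  have : Nonempty {δ : Ξ // extend (E δ) (z δ) ≤ E ξ} := ⟨⟨η, hη⟩⟩
  have hle : monomialSpan (LinearMap.mul k H) B E z ord (E ξ) ≤
      Subalgebra.toSubmodule (⨆ δ, T δ) := by
    refine Submodule.span_le.2 ?_
    rintro _ ⟨b, hb, r, hr, rfl⟩
    refine Subalgebra.mul_mem _ ?_ (monomial_mem ord fun δ hδ => ?_)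
    · exact le_iSup T ⟨η, hη⟩ (le_extend (h.base_le η hb))
    · exact le_iSup T ⟨δ, hr δ hδ⟩ self_mem_extend
  have hmem : a ∈ ((⨆ δ, T δ : Subalgebra k H) : Set H) := hle ha
  rw [Subalgebra.coe_iSup_of_directed hdir, Set.mem_iUnion] at hmem
  obtain ⟨δ, hδ⟩ := hmem
  exact ⟨δ, δ.2, hδ⟩

end Order

/-! ### Assembly of the PBW generators -/

section Main

variable {k : Type u} {H : Type v} [Field k] [CharZero k] [Ring H] [HopfAlgebra k H]
variable {Γ : Type w} [AddCommMonoid Γ] [LinearOrder Γ] [IsOrderedCancelAddMonoid Γ]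
variable [WellFoundedLT Γ] {𝒜 : Γ → Submodule k H} [GradedAlgebra 𝒜]

theorem isCoidealPair_zero (hconn : ∀ y ∈ 𝒜 0, ∃ c : k, y = c • (1 : H)) {s : Side}
    {A B : Subalgebra k H} (hBA : B ≤ A) (hAhom : DirectSum.SetLike.IsHomogeneous 𝒜 A)
    (hBhom : DirectSum.SetLike.IsHomogeneous 𝒜 B)
    (hA : IsCoideal s (Subalgebra.toSubmodule A)) (hB : IsCoideal s (Subalgebra.toSubmodule B)) :
    IsCoidealPair 𝒜 (sideComul k H s) 0 B A where
  le := hBA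
  homC := fun _ hx γ => hBhom γ hx
  homD := fun _ hx γ => hAhom γ hx
  coidealC := isCoideal_iff.1 hB
  coidealD := isCoideal_iff.1 hA
  degree := by
    refine fun γ a _ haγ haB => ⟨γ, ?_, (zero_add γ).symm⟩
    rintro rfl
    obtain ⟨c, rfl⟩ := hconn a haγ
    exact haB (B.smul_mem (one_mem B) c)

theorem exists_pbw (hgr : IsCoalgebraGrading 𝒜) (hconn : ∀ y ∈ 𝒜 0, ∃ c : k, y = c • (1 : H))
    (s : Side) (A B : Subalgebra k H) (hBA : B ≤ A)
    (hAhom : DirectSum.SetLike.IsHomogeneous 𝒜 A) (hBhom : DirectSum.SetLike.IsHomogeneous 𝒜 B)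
    (hA : IsCoideal s (Subalgebra.toSubmodule A)) (hB : IsCoideal s (Subalgebra.toSubmodule B)) :
    ∃ (Ξ : Type v) (z : Ξ → H) (ord : LinearOrder Ξ),
      (∀ ξ, z ξ ∈ A ∧ ∃ γ : Γ, γ ≠ 0 ∧ z ξ ∈ 𝒜 γ) ∧
      (∀ ord' : LinearOrder Ξ, IsPBWSystem B A z (fun _ => ⊤) ord') ∧
      (∀ ξ,
        IsLeftBasis B (truncation B z ord ξ)
          (fun r : {r : Ξ →₀ ℕ // ∀ η ∈ r.support, η ≤ ξ} => monomial ord z r.1) ∧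
        IsRightBasis B (truncation B z ord ξ)
          (fun r : {r : Ξ →₀ ℕ // ∀ η ∈ r.support, η ≤ ξ} => monomial ord z r.1)) ∧
      (∀ ξ, IsCoideal s (Subalgebra.toSubmodule (truncation B z ord ξ)) ∧
        (IsHopfSubalgebra A → IsHopfSubalgebra B → IsHopfSubalgebra (truncation B z ord ξ))) ∧
      (∀ ξ η, η < ξ → ∃ δ, δ < ξ ∧ z ξ * z η - z η * z ξ ∈ truncation B z ord δ) := by
  have hΔ := isConnectedComul_sideComul hgr hconn s
  have hpair := isCoidealPair_zero hconn hBA hAhom hBhom hA hB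
  -- The degree is quantified away so that the index type stays in the universe of H.
  let Ξ : Type v := {q : Subalgebra k H × H // ∃ γ, Jump 𝒜 B A q.1 (γ, q.2)}
  let E : Ξ → Subalgebra k H := fun ξ => ξ.1.1
  let z : Ξ → H := fun ξ => ξ.1.2
  let d : Ξ → Γ := fun ξ => ξ.2.choose
  have hjump : ∀ ξ, Jump 𝒜 B A (E ξ) (d ξ, z ξ) := fun ξ => ξ.2.choose_spec
  have hJ : ∀ F q, Jump 𝒜 B A F q → ∃ ξ, E ξ = F ∧ z ξ = q.2 := fun F q hF =>
    ⟨⟨(F, q.2), q.1, hF⟩, rfl, rfl⟩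
  have hchain : IsOreChain 𝒜 (sideComul k H s) B E z d :=
    { step := fun ξ => (hjump ξ).isOreStep hΔ 0 hpair
      base_le := fun ξ => ((hjump ξ).bounds hBA).1
      total := fun ξ η => by
        rcases (hjump ξ).comparable (hjump η) with h | h | ⟨h1, h2⟩
        · exact Or.inl h
        · exact Or.inr (Or.inl h)
        · exact Or.inr (Or.inr (Subtype.ext (Prod.ext h1 (Prod.mk.inj h2).2))) }
  have hTA : ∀ ξ, extend (E ξ) (z ξ) ≤ A := fun ξ => ((hjump ξ).bounds hBA).2
  have hTspan : ∀ act : H →ₗ[k] H →ₗ[k] H, IsMulAction act → ∀ ord ξ,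
      Subalgebra.toSubmodule (extend (E ξ) (z ξ)) ≤
        monomialSpan act B E z ord (extend (E ξ) (z ξ)) := fun act hact ord ξ =>
    IsHom.le_of_homogeneous (𝒜 := 𝒜)
      (isHom_adjoin_union (hchain.step ξ).isHom fun x hx => ⟨d ξ, by
        rw [Set.mem_singleton_iff.1 hx]
        exact (hchain.step ξ).mem_deg⟩)
      fun γ a ha haγ => hchain.extend_spanned hact hpair.homC ord ξ
        (fun β _ => (hchain.spanned hΔ hact ord hpair hJ β).2 _ _ (hjump ξ)) ha haγ
  have hEspan : ∀ act : H →ₗ[k] H →ₗ[k] H, IsMulAction act → ∀ ord ξ,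
      Subalgebra.toSubmodule (E ξ) ≤ monomialSpan act B E z ord (E ξ) := fun act hact ord ξ =>
    (hchain.step ξ).isHom.le_of_homogeneous fun γ =>
      (hchain.spanned hΔ hact ord hpair hJ γ).2 _ _ (hjump ξ)
  have hAspan : ∀ act : H →ₗ[k] H →ₗ[k] H, IsMulAction act → ∀ ord,
      Subalgebra.toSubmodule A ≤ monomialSpan act B E z ord A := fun act hact ord =>
    hpair.homD.le_of_homogeneous fun γ => (hchain.spanned hΔ hact ord hpair hJ γ).1
  have htrunc : ∀ ξ, truncation B z hchain.linearOrder ξ = extend (E ξ) (z ξ) := fun ξ =>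
    hchain.truncation_eq ξ (hTspan _ (Or.inl rfl) _ ξ)
  have hrangeA : ∀ r : Ξ →₀ ℕ,
      r ∈ Set.range (Subtype.val : {r : Ξ →₀ ℕ // ∀ ξ, (r ξ : ℕ∞) < ⊤} → Ξ →₀ ℕ) ↔
        ∀ ξ ∈ r.support, extend (E ξ) (z ξ) ≤ A := fun r =>
    ⟨fun _ ξ _ => hTA ξ, fun _ => ⟨⟨r, fun ξ => ENat.natCast_lt_top _⟩, rfl⟩⟩
  have hrangeT : ∀ ξ : Ξ, ∀ r : Ξ →₀ ℕ,
      r ∈ Set.range (Subtype.val :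
        {r : Ξ →₀ ℕ // ∀ η ∈ r.support, hchain.linearOrder.le η ξ} → Ξ →₀ ℕ) ↔
        ∀ η ∈ r.support, extend (E η) (z η) ≤ extend (E ξ) (z ξ) := fun ξ r =>
    ⟨fun ⟨q, e⟩ => e ▸ q.2, fun h => ⟨⟨r, h⟩, rfl⟩⟩
  refine ⟨Ξ, z, hchain.linearOrder, fun ξ => ⟨hTA ξ self_mem_extend, d ξ,
    (hchain.step ξ).ne_zero hΔ, (hchain.step ξ).mem_deg⟩, fun ord' => ?_, fun ξ => ?_, fun ξ => ?_,
    fun ξ η hlt => ?_⟩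
  · exact ⟨fun ξ => hTA ξ self_mem_extend, fun _ => le_top,
      hchain.isLeftBasis hΔ ord' hBA (hAspan _ (Or.inl rfl) ord') Subtype.val_injective hrangeA,
      hchain.isRightBasis hΔ ord' hBA (hAspan _ (Or.inr rfl) ord') Subtype.val_injective hrangeA⟩
  · rw [htrunc]
    have hBT : B ≤ extend (E ξ) (z ξ) := (hchain.base_le ξ).trans le_extend
    exact ⟨hchain.isLeftBasis hΔ _ hBT (hTspan _ (Or.inl rfl) _ ξ) Subtype.val_injective
        (hrangeT ξ),
      hchain.isRightBasis hΔ _ hBT (hTspan _ (Or.inr rfl) _ ξ) Subtype.val_injective (hrangeT ξ)⟩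
  · rw [htrunc]
    have hco : ∀ s, IsCoideal s (Subalgebra.toSubmodule A) →
        IsCoideal s (Subalgebra.toSubmodule B) →
        IsCoideal s (Subalgebra.toSubmodule (extend (E ξ) (z ξ))) := fun s hA hB => by
      -- `Jump` does not involve the comultiplication, so the same steps are Ore steps for either
      -- side on which A and B are coideals.
      have hs := (hjump ξ).isOreStep (isConnectedComul_sideComul hgr hconn s) 0
        (isCoidealPair_zero hconn hBA hAhom hBhom hA hB)
      refine isCoideal_iff.2 (comul_mem_adjoin_union hs.coideal fun x hx => ?_)
      rw [Set.mem_singleton_iff.1 hx]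
      exact tensorSub_mono le_rfl (le_extend (E := E ξ) (x := z ξ)) hs.comul_sub_mem
    refine ⟨hco s hA hB, fun hA' hB' => isHopfSubalgebra_of_isCoideal hgr hconn ?_ fun s =>
      hco s (hA'.isCoideal s) (hB'.isCoideal s)⟩
    refine isHom_adjoin_union (hchain.step ξ).isHom fun x hx => ⟨d ξ, ?_⟩
    rw [Set.mem_singleton_iff.1 hx]
    exact (hchain.step ξ).mem_deg
  · have hle := hchain.extend_le_of_lt hlt
    obtain ⟨δ, hδ, hmem⟩ := hchain.exists_mem_extend hle
      (hEspan _ (Or.inl rfl) hchain.linearOrder ξ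
        ((hchain.step ξ).ad_mem _ (hle self_mem_extend)))
    refine ⟨δ, hchain.lt_of_extend_le hδ, ?_⟩
    rw [htrunc]
    exact hmem

end Main

end CoidealPBW

theorem mainTheorem4
    {k : Type u} [Field k] [CharZero k]
    {Γ : Type w} [AddCommMonoid Γ] [DecidableEq Γ] [Nontrivial Γ]
    (hΓ : ∃ r : Γ → Γ → Prop, CoidealPBW.IsAdmissibleWellOrder r)
    {H : Type v} [Ring H] [HopfAlgebra k H]
    (𝒜 : Γ → Submodule k H) [GradedAlgebra 𝒜]
    (hgr : CoidealPBW.IsCoalgebraGrading 𝒜)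
    (hconn : Module.finrank k (𝒜 0) = 1)
    (s : CoidealPBW.Side)
    (A B : Subalgebra k H) (hBA : B ≤ A)
    (hAhom : DirectSum.SetLike.IsHomogeneous 𝒜 A)
    (hBhom : DirectSum.SetLike.IsHomogeneous 𝒜 B)
    (hA : CoidealPBW.IsCoideal s (Subalgebra.toSubmodule A))
    (hB : CoidealPBW.IsCoideal s (Subalgebra.toSubmodule B)) :
    ∃ (Ξ : Type v) (z : Ξ → H) (ord : LinearOrder Ξ),
      -- each `z ξ` is a homogeneous element of the positive part of `A`
      (∀ ξ, z ξ ∈ A ∧ ∃ γ : Γ, γ ≠ 0 ∧ z ξ ∈ 𝒜 γ) ∧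
      -- PBW generators with infinite heights, for every total order
      (∀ ord' : LinearOrder Ξ, CoidealPBW.IsPBWSystem B A z (fun _ => ⊤) ord') ∧
      -- PBW bases of the truncations
      (∀ ξ,
        CoidealPBW.IsLeftBasis B (CoidealPBW.truncation B z ord ξ)
          (fun r : {r : Ξ →₀ ℕ // ∀ η ∈ r.support, η ≤ ξ} =>
            CoidealPBW.monomial ord z r.1) ∧
        CoidealPBW.IsRightBasis B (CoidealPBW.truncation B z ord ξ)
          (fun r : {r : Ξ →₀ ℕ // ∀ η ∈ r.support, η ≤ ξ} =>
            CoidealPBW.monomial ord z r.1)) ∧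
      -- the truncations are coideals, or Hopf subalgebras
      (∀ ξ, CoidealPBW.IsCoideal s
          (Subalgebra.toSubmodule (CoidealPBW.truncation B z ord ξ)) ∧
        (CoidealPBW.IsHopfSubalgebra A → CoidealPBW.IsHopfSubalgebra B →
          CoidealPBW.IsHopfSubalgebra (CoidealPBW.truncation B z ord ξ))) ∧
      -- commutators
      (∀ ξ η, η < ξ →
        ∃ δ, δ < ξ ∧ z ξ * z η - z η * z ξ ∈ CoidealPBW.truncation B z ord δ) := by
  obtain ⟨r, hr, hadd⟩ := hΓ
  classical
  let ordΓ : LinearOrder Γ := linearOrderOfSTO r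
  -- The grading depends on a decidable equality on Γ, which has to be that of the new linear order.
  obtain rfl : ‹DecidableEq Γ› = ordΓ.toDecidableEq := Subsingleton.elim _ _
  have : WellFoundedLT Γ := ⟨hr.wf⟩
  have : IsOrderedCancelAddMonoid Γ :=
    IsOrderedCancelAddMonoid.of_add_lt_add_left fun a b c h => hadd b c a h
  refine CoidealPBW.exists_pbw hgr (fun y hy => ?_) s A B hBA hAhom hBhom hA hB
  have h0 : (⟨1, SetLike.GradedOne.one_mem⟩ : 𝒜 0) ≠ 0 := fun e => by
    have h1 : (1 : H) = 0 := congrArg Subtype.val e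
    have h2 : Subsingleton (𝒜 0) := ⟨fun a b => Subtype.ext <| by
      rw [← mul_one (a : H), ← mul_one (b : H), h1, mul_zero, mul_zero]⟩
    rw [Module.finrank_zero_of_subsingleton] at hconn
    exact zero_ne_one hconn
  obtain ⟨c, hc⟩ := (finrank_eq_one_iff_of_nonzero' _ h0).1 hconn ⟨y, hy⟩
  exact ⟨c, (congrArg Subtype.val hc).symm⟩
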